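/- Consider a single-server queue that is empty at time $0$, in which customers arrive according to a Poisson process with rate $\lambda>0$ and have i.i.d. service times $B_1,B_2,\ldots\ge 0$, independent of the arrival process, with generic service time $B$ and load $\rho=\lambda EB<1$. Under the Foreground Background (FB) discipline, service is given at each time to the customer(s) present that have received the least amount of service so far; if there are $m$ such customers, each of them is served at rate $1/m$. Under the discipline FB$^*$, the customer that starts the busy period has the lowest priority and is served (at rate $1$) only when no other customers are present, and the other customers are served according to the FB discipline. Let $M$ and $M^*$ be the maximum queue length (number of customers in the system, including those in service, with every customer counted at least at its arrival epoch) during the first busy period under FB and under FB$^*$, respectively. Then for every integer $n\ge 1$, $$P(M^*>n)=1-E\,e^{-\lambda P(M>n-1)\,B}.$$ -/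

import Mathlib

open MeasureTheory ProbabilityTheory

noncomputable section

namespace SingleServerQueue

/-- State of a single-server queue immediately after an event. Customers are numbered
`0, 1, 2, …` in order of arrival. An event is an arrival, a departure, or an instant at which the
customers in service have reached the age of an older customer competing with them for service. -/
structure State where
  /-- number of customers that have arrived so far (hence also the index of the next one) -/
  arrived : ℕ
  /-- the customer that started the current (or, if the queue is empty, the latest) busy period -/
  starter : ℕ
  /-- the customers present in the system -/
  present : Finset ℕ
  /-- amount of service received so far by each customer -/
  age : ℕ → ℝ
  /-- time left until the next arrival -/
  wait : ℝ

/-- A rule which, given the starter of the busy period and the set of customers present, selects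
the customers of highest priority. Service goes to those only, and among them it follows the
Foreground Background rule. -/
abbrev PriorityRule := ℕ → Finset ℕ → Finset ℕ

/-- `FB`: all the customers present have the same priority. -/
def fb : PriorityRule := fun _ S => S

/-- `FB*`: the customer that started the busy period has the lowest priority, and is served only
when nobody else is present. -/
def fbStar : PriorityRule := fun s S => if S.erase s = ∅ then S else S.erase s

/-- The customers of the set `E` that have received the least amount of service. -/
def youngest (age : ℕ → ℝ) (E : Finset ℕ) : Finset ℕ :=
  E.filter fun i => ∀ j ∈ E, age i ≤ age j

/-- The customers in service: the youngest ones among those of highest priority. If there are `m`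
of them, each is served at rate `1 / m`. -/
def inService (R : PriorityRule) (s : State) : Finset ℕ :=
  youngest s.age (R s.starter s.present)

/-- Time until the next event when customer `i` requires an amount `b i` of service. It is the
minimum of the time until the next arrival, of the times that the customers in service would need
to complete their service, and of the times that they would need to reach the ages of the other
customers of highest priority. -/
def holdingTime (R : PriorityRule) (b : ℕ → ℝ) (s : State) : ℝ :=
  let Y := inService R s
  let O := R s.starter s.present \ Y
  min s.wait
    (min (Y.fold min s.wait fun i => (Y.card : ℝ) * (b i - s.age i))
      ((Y ×ˢ O).fold min s.wait fun p => (Y.card : ℝ) * (s.age p.2 - s.age p.1)))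

/-- The ages at the next event. -/
def nextAge (R : PriorityRule) (b : ℕ → ℝ) (s : State) : ℕ → ℝ := fun i =>
  if i ∈ inService R s then s.age i + holdingTime R b s / ((inService R s).card : ℝ) else s.age i

/-- The customers present at the next event whose service is then still incomplete (not counting a
customer that arrives at that event). -/
def remaining (R : PriorityRule) (b : ℕ → ℝ) (s : State) : Finset ℕ :=
  s.present.filter fun i => i ∉ inService R s ∨ nextAge R b s i < b i

/-- The state immediately after the next event. Here `a i` is the time between the arrivals of
customers `i - 1` and `i` (from time `0` on for `i = 0`), and `b i` the service time of customer
`i`. Customers whose service is complete leave; if the event is an arrival, the new customer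
joins, with age `0`, and starts a busy period if it finds nobody present. -/
def step (R : PriorityRule) (a b : ℕ → ℝ) (s : State) : State :=
  if holdingTime R b s = s.wait then
    { arrived := s.arrived + 1
      starter := if remaining R b s = ∅ then s.arrived else s.starter
      present := insert s.arrived (remaining R b s)
      age := nextAge R b s
      wait := a (s.arrived + 1) }
  else
    { arrived := s.arrived
      starter := s.starter
      present := remaining R b s
      age := nextAge R b s
      wait := s.wait - holdingTime R b s }

/-- The queue is empty at time `0`, and customer `0` arrives at time `a 0`. -/
def init (a : ℕ → ℝ) : State where
  arrived := 0
  starter := 0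
  present := ∅
  age := fun _ => 0
  wait := a 0

/-- The state after `k` events. Event number `1` is the arrival of customer `0`. -/
def stateAt (R : PriorityRule) (a b : ℕ → ℝ) (k : ℕ) : State :=
  (step R a b)^[k] (init a)

/-- Queue length (number of customers in the system, including those in service) from event `k` up
to the next event. -/
def queueLength (R : PriorityRule) (a b : ℕ → ℝ) (k : ℕ) : ℕ :=
  (stateAt R a b k).present.card

/-- Maximum queue length in the first busy period, which begins at event `1`, the arrival of
customer `0`, and lasts until the queue is empty again. The queue length being constant between
events, the maximum is taken over the events `k` up to which the queue has stayed nonempty (`k = 0`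
contributes the value `0`). -/
def busyPeriodMax (R : PriorityRule) (a b : ℕ → ℝ) : ℕ∞ :=
  ⨆ (k : ℕ) (_ : ∀ j ∈ Finset.Icc 1 k, queueLength R a b j ≠ 0), (queueLength R a b k : ℕ∞)

end SingleServerQueue

end

noncomputable section

namespace SingleServerQueue

/-! ### Holding times and relabelling of customers -/

theorem le_holdingTime_iff {R : PriorityRule} {b : ℕ → ℝ} {s : State} {c : ℝ} :
    c ≤ holdingTime R b s ↔ c ≤ s.wait ∧
      (∀ i ∈ inService R s, c ≤ ((inService R s).card : ℝ) * (b i - s.age i)) ∧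
      ∀ i ∈ inService R s, ∀ j ∈ R s.starter s.present \ inService R s,
        c ≤ ((inService R s).card : ℝ) * (s.age j - s.age i) := by
  simp only [holdingTime, le_min_iff, Finset.le_fold_min, Finset.mem_product, Prod.forall]
  constructor
  · rintro ⟨h1, ⟨-, h2⟩, -, h3⟩
    exact ⟨h1, h2, fun i hi j hj => h3 i j ⟨hi, hj⟩⟩
  · rintro ⟨h1, h2, h3⟩
    exact ⟨h1, ⟨h1, h2⟩, h1, fun i j h => h3 i h.1 j h.2⟩

theorem holdingTime_le_wait (R : PriorityRule) (b : ℕ → ℝ) (s : State) :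
    holdingTime R b s ≤ s.wait := (le_holdingTime_iff.1 le_rfl).1

theorem mem_inService {R : PriorityRule} {s : State} {i : ℕ} :
    i ∈ inService R s ↔ i ∈ R s.starter s.present ∧
      ∀ j ∈ R s.starter s.present, s.age i ≤ s.age j := by
  simp [inService, youngest]

theorem nextAge_of_mem {R : PriorityRule} {b : ℕ → ℝ} {s : State} {i : ℕ}
    (h : i ∈ inService R s) :
    nextAge R b s i = s.age i + holdingTime R b s / ((inService R s).card : ℝ) := if_pos h

theorem nextAge_of_notMem {R : PriorityRule} {b : ℕ → ℝ} {s : State} {i : ℕ}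
    (h : i ∉ inService R s) : nextAge R b s i = s.age i := if_neg h

theorem mem_remaining {R : PriorityRule} {b : ℕ → ℝ} {s : State} {i : ℕ} :
    i ∈ remaining R b s ↔ i ∈ s.present ∧ (i ∉ inService R s ∨ nextAge R b s i < b i) := by
  simp [remaining]

section Relabel

variable {R R' : PriorityRule} {b b' : ℕ → ℝ} {s s' : State} (φ : ℕ ↪ ℕ) {δ : ℝ}

theorem inService_map
    (hE : R s.starter s.present = (R' s'.starter s'.present).map φ)
    (hage : ∀ i ∈ R' s'.starter s'.present, s.age (φ i) = s'.age i + δ) :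
    inService R s = (inService R' s').map φ := by
  ext k
  simp only [mem_inService, hE, Finset.mem_map]
  constructor
  · rintro ⟨⟨i, hi, rfl⟩, h⟩
    refine ⟨i, ⟨hi, fun j hj => ?_⟩, rfl⟩
    have := h (φ j) ⟨j, hj, rfl⟩
    rw [hage i hi, hage j hj] at this
    linarith
  · rintro ⟨i, ⟨hi, h⟩, rfl⟩
    refine ⟨⟨i, hi, rfl⟩, ?_⟩
    rintro _ ⟨j, hj, rfl⟩
    rw [hage i hi, hage j hj]
    linarith [h j hj]

theorem holdingTime_map
    (hE : R s.starter s.present = (R' s'.starter s'.present).map φ)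
    (hage : ∀ i ∈ R' s'.starter s'.present, s.age (φ i) = s'.age i + δ)
    (hb : ∀ i ∈ R' s'.starter s'.present, b (φ i) = b' i + δ)
    (hw : s.wait = s'.wait) :
    holdingTime R b s = holdingTime R' b' s' := by
  refine eq_of_forall_le_iff fun c => ?_
  rw [le_holdingTime_iff, le_holdingTime_iff, inService_map φ hE hage, hE, hw]
  simp only [Finset.card_map, ← Finset.map_sdiff, Finset.forall_mem_map]
  refine and_congr_right fun _ => and_congr ?_ ?_
  · refine forall₂_congr fun i hi => ?_
    have hi' := (mem_inService.1 hi).1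
    rw [hage i hi', hb i hi']
    ring_nf
  · refine forall₂_congr fun i hi => forall₂_congr fun j hj => ?_
    rw [hage i (mem_inService.1 hi).1, hage j (Finset.mem_sdiff.1 hj).1]
    ring_nf

theorem nextAge_map
    (hE : R s.starter s.present = (R' s'.starter s'.present).map φ)
    (hage : ∀ i ∈ R' s'.starter s'.present, s.age (φ i) = s'.age i + δ)
    (hb : ∀ i ∈ R' s'.starter s'.present, b (φ i) = b' i + δ)
    (hw : s.wait = s'.wait) (i : ℕ) :
    nextAge R b s (φ i) - s.age (φ i) = nextAge R' b' s' i - s'.age i := by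
  have hY := inService_map φ hE hage
  by_cases hi : i ∈ inService R' s'
  · have hi2 : φ i ∈ inService R s := by rw [hY]; exact Finset.mem_map_of_mem _ hi
    rw [nextAge_of_mem hi, nextAge_of_mem hi2, holdingTime_map φ hE hage hb hw, hY,
      Finset.card_map]
    ring
  · have hi2 : φ i ∉ inService R s := by
      rw [hY]
      simpa using hi
    rw [nextAge_of_notMem hi, nextAge_of_notMem hi2]
    ring

theorem mem_remaining_map
    (hE : R s.starter s.present = (R' s'.starter s'.present).map φ)
    (hage : ∀ i ∈ R' s'.starter s'.present, s.age (φ i) = s'.age i + δ)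
    (hb : ∀ i ∈ R' s'.starter s'.present, b (φ i) = b' i + δ)
    (hw : s.wait = s'.wait) {i : ℕ} (hi : φ i ∈ s.present ↔ i ∈ s'.present) :
    φ i ∈ remaining R b s ↔ i ∈ remaining R' b' s' := by
  rw [mem_remaining, mem_remaining, hi, inService_map φ hE hage]
  refine and_congr_right fun _ => ?_
  rw [Finset.mem_map' φ, ← imp_iff_not_or, ← imp_iff_not_or]
  refine imp_congr_right fun hY => ?_
  have hE' := (mem_inService.1 hY).1
  have := nextAge_map φ hE hage hb hw i
  rw [hage i hE'] at this
  rw [hb i hE']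
  constructor <;> intro h <;> linarith

end Relabel

/-! ### Running the queue through a busy period -/

/-- The queue length stays at most `n` until the queue, started in state `s`, is empty. -/
def BusyLe (R : PriorityRule) (a b : ℕ → ℝ) (n : ℕ) (s : State) : Prop :=
  ∀ k, (∀ j ≤ k, ((step R a b)^[j] s).present ≠ ∅) → ((step R a b)^[k] s).present.card ≤ n

/-- The queue, started in state `s`, is empty for the first time after `T` events. -/
def EndsIn (R : PriorityRule) (a b : ℕ → ℝ) (T : ℕ) (s : State) : Prop :=
  ((step R a b)^[T] s).present = ∅ ∧ ∀ j < T, ((step R a b)^[j] s).present ≠ ∅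

theorem busyLe_of_empty {R : PriorityRule} {a b : ℕ → ℝ} {n : ℕ} {s : State}
    (h : s.present = ∅) : BusyLe R a b n s := fun _ hk => absurd h (hk 0 (Nat.zero_le _))

theorem busyLe_iff {R : PriorityRule} {a b : ℕ → ℝ} {n : ℕ} {s : State}
    (h : s.present ≠ ∅) :
    BusyLe R a b n s ↔ s.present.card ≤ n ∧ BusyLe R a b n (step R a b s) := by
  constructor
  · intro H
    refine ⟨H 0 fun j hj => ?_, fun k hk => ?_⟩
    · rwa [Nat.le_zero.1 hj]
    · have := H (k + 1) fun j hj => ?_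
      · rwa [Function.iterate_succ_apply] at this
      · cases j with
        | zero => exact h
        | succ j => rw [Function.iterate_succ_apply]; exact hk j (by omega)
  · rintro ⟨h1, h2⟩ k hk
    cases k with
    | zero => exact h1
    | succ k =>
      rw [Function.iterate_succ_apply]
      refine h2 k fun j hj => ?_
      rw [← Function.iterate_succ_apply]
      exact hk (j + 1) (by omega)

theorem endsIn_succ {R : PriorityRule} {a b : ℕ → ℝ} {T : ℕ} {s : State} :
    EndsIn R a b (T + 1) s ↔ s.present ≠ ∅ ∧ EndsIn R a b T (step R a b s) := by
  constructor
  · rintro ⟨h1, h2⟩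
    refine ⟨h2 0 (Nat.succ_pos _), by rwa [Function.iterate_succ_apply] at h1, fun j hj => ?_⟩
    rw [← Function.iterate_succ_apply]
    exact h2 _ (by omega)
  · rintro ⟨h0, h1, h2⟩
    refine ⟨by rwa [Function.iterate_succ_apply], fun j hj => ?_⟩
    cases j with
    | zero => exact h0
    | succ j => rw [Function.iterate_succ_apply]; exact h2 j (by omega)

/-- The state after the first arrival. -/
def start (a : ℕ → ℝ) : State where
  arrived := 1
  starter := 0
  present := {0}
  age := fun _ => 0
  wait := a 1

theorem step_congr {R : PriorityRule} {a a' b : ℕ → ℝ} (h : ∀ i, 1 ≤ i → a i = a' i) :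
    step R a b = step R a' b := by
  funext s
  simp [step, h (s.arrived + 1) (by omega)]

theorem step_init {R : PriorityRule} (hR : ∀ i, R i ∅ = ∅) (a b : ℕ → ℝ) :
    step R a b (init a) = start a := by
  have hY : inService R (init a) = ∅ := by
    simp [inService, youngest, init, hR]
  have hh : holdingTime R b (init a) = (init a).wait := by
    simp [holdingTime, hY]
  have hr : remaining R b (init a) = ∅ := by
    ext i
    simp [mem_remaining, init]
  have hn : nextAge R b (init a) = fun _ => 0 := by
    funext i
    rw [nextAge_of_notMem (by simp [hY])]
    rfl
  rw [step, if_pos hh, hr, hn]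
  simp [start, init]

theorem busyPeriodMax_le_iff {R : PriorityRule} (hR : ∀ i, R i ∅ = ∅) (a b : ℕ → ℝ) (n : ℕ) :
    busyPeriodMax R a b ≤ n ↔ BusyLe R a b n (start a) := by
  have hs : ∀ k, stateAt R a b (k + 1) = (step R a b)^[k] (start a) := fun k => by
    rw [stateAt, Function.iterate_succ_apply, step_init hR]
  simp only [busyPeriodMax, iSup_le_iff, Nat.cast_le, queueLength]
  constructor
  · intro H k hk
    rw [← hs]
    refine H (k + 1) fun j hj => ?_
    obtain ⟨h1, h2⟩ := Finset.mem_Icc.1 hj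
    obtain ⟨i, rfl⟩ := Nat.exists_eq_add_of_le' h1
    rw [hs, Finset.card_ne_zero, Finset.nonempty_iff_ne_empty]
    exact hk i (by omega)
  · intro H k hk
    cases k with
    | zero => simp [stateAt, init]
    | succ k =>
      rw [hs]
      refine H k fun j hj => ?_
      have := hk (j + 1) (Finset.mem_Icc.2 ⟨by omega, by omega⟩)
      rwa [hs, Finset.card_ne_zero, Finset.nonempty_iff_ne_empty] at this

theorem fb_empty (i : ℕ) : fb i ∅ = ∅ := rfl

theorem fbStar_empty (i : ℕ) : fbStar i ∅ = ∅ := by simp [fbStar]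

/-! ### A busy period nested in the service of the starter -/

/-- The state `s` of a queue under `FB*` whose starter, customer `0`, has received an amount `t`
of service, seen next to the state `s'` of the queue under `FB` formed by the other customers. -/
structure Nested (t : ℝ) (s s' : State) : Prop where
  starter : s.starter = 0
  arrived : s.arrived = s'.arrived + 1
  present : s.present = insert 0 (s'.present.map ⟨Nat.succ, Nat.succ_injective⟩)
  age : ∀ i, s.age (i + 1) = s'.age i
  age_zero : s.age 0 = t
  wait : s.wait = s'.wait

theorem Nested.card {t : ℝ} {s s' : State} (h : Nested t s s') :
    s.present.card = s'.present.card + 1 := by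
  rw [h.present, Finset.card_insert_of_notMem (by simp), Finset.card_map]

theorem Nested.rule {t : ℝ} {s s' : State} (h : Nested t s s') (hne : s'.present ≠ ∅) :
    fbStar s.starter s.present = (fb s'.starter s'.present).map ⟨Nat.succ, Nat.succ_injective⟩ := by
  have : s.present.erase 0 = s'.present.map ⟨Nat.succ, Nat.succ_injective⟩ := by
    rw [h.present, Finset.erase_insert (by simp)]
  rw [fbStar, h.starter, this, if_neg (by simpa using hne), fb]

theorem Nested.step {t : ℝ} {s s' : State} {a b a' b' : ℕ → ℝ} (h : Nested t s s')
    (hne : s'.present ≠ ∅) (ha : ∀ i, 1 ≤ i → a (i + 1) = a' i) (hb : ∀ i, b (i + 1) = b' i) :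
    Nested t (step fbStar a b s) (step fb a' b' s') := by
  have hE := h.rule hne
  have hage : ∀ i ∈ fb s'.starter s'.present,
      s.age ((⟨Nat.succ, Nat.succ_injective⟩ : ℕ ↪ ℕ) i) = s'.age i + 0 := fun i _ => by
    rw [add_zero]; exact h.age i
  have hb' : ∀ i ∈ fb s'.starter s'.present,
      b ((⟨Nat.succ, Nat.succ_injective⟩ : ℕ ↪ ℕ) i) = b' i + 0 := fun i _ => by
    rw [add_zero]; exact hb i
  have hH := holdingTime_map _ hE hage hb' h.wait
  have hN : ∀ i, nextAge fbStar b s (i + 1) = nextAge fb b' s' i := fun i => by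
    have := nextAge_map _ hE hage hb' h.wait i
    have h2 := h.age i
    change nextAge fbStar b s (i + 1) - s.age (i + 1) = _ at this
    linarith
  have h0 : (0 : ℕ) ∉ inService fbStar s := by
    rw [inService_map _ hE hage]
    simp
  have hN0 : nextAge fbStar b s 0 = t := by rw [nextAge_of_notMem h0, h.age_zero]
  have hP : remaining fbStar b s =
      insert 0 ((remaining fb b' s').map ⟨Nat.succ, Nat.succ_injective⟩) := by
    ext k
    cases k with
    | zero => simp [mem_remaining, h0, h.present]
    | succ k =>
      have := mem_remaining_map (i := k) _ hE hage hb' h.wait (by simp [h.present])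
      change k + 1 ∈ _ ↔ _ at this
      simp [this]
  rw [SingleServerQueue.step, SingleServerQueue.step, hH, h.wait]
  by_cases hc : holdingTime fb b' s' = s'.wait
  · rw [if_pos hc, if_pos hc]
    refine ⟨?_, ?_, ?_, hN, hN0, ?_⟩
    · simp [hP, h.starter]
    · simp [h.arrived]
    · simp [hP, h.arrived, Finset.insert_comm]
    · simp only [h.arrived]
      exact ha _ (by omega)
  · rw [if_neg hc, if_neg hc]
    exact ⟨h.starter, h.arrived, hP, hN, hN0, by simp⟩

theorem Nested.busyLe_iff {t : ℝ} {a b a' b' : ℕ → ℝ} {m : ℕ}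
    (ha : ∀ i, 1 ≤ i → a (i + 1) = a' i) (hb : ∀ i, b (i + 1) = b' i) :
    ∀ (T : ℕ) {s s' : State}, Nested t s s' → EndsIn fb a' b' T s' →
      (BusyLe fbStar a b (m + 1) s ↔
        BusyLe fb a' b' m s' ∧ BusyLe fbStar a b (m + 1) ((SingleServerQueue.step fbStar a b)^[T] s))
      ∧ Nested t ((SingleServerQueue.step fbStar a b)^[T] s)
          ((SingleServerQueue.step fb a' b')^[T] s')
  | 0, s, s', h, hT => by
    refine ⟨?_, h⟩
    have : BusyLe fb a' b' m s' := busyLe_of_empty hT.1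
    simp [this]
  | T + 1, s, s', h, hT => by
    obtain ⟨hne, hT'⟩ := endsIn_succ.1 hT
    obtain ⟨ih, ih2⟩ := Nested.busyLe_iff (m := m) ha hb T (h.step hne ha hb) hT'
    have hne2 : s.present ≠ ∅ := by rw [h.present]; simp
    refine ⟨?_, ih2⟩
    rw [SingleServerQueue.busyLe_iff hne2, SingleServerQueue.busyLe_iff hne, ih, h.card,
      Function.iterate_succ_apply, Nat.add_le_add_iff_right, and_assoc]

/-- Relabelling that keeps customer `0` and drops the customers `1, …, K`. -/
def skip (K : ℕ) : ℕ ↪ ℕ where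
  toFun i := if i = 0 then 0 else i + K
  inj' i j h := by
    dsimp only at h
    split_ifs at h <;> omega

@[simp] theorem skip_zero (K : ℕ) : skip K 0 = 0 := rfl

theorem skip_of_pos (K : ℕ) {i : ℕ} (h : 1 ≤ i) : skip K i = i + K := if_neg (by omega)

/-- The states `s` and `s'` of two queues under `FB*` coincide, except that in `s` customers
`1, …, K` have already come and gone, and customer `0` has received an additional amount `t` of
service. -/
structure Resumed (K : ℕ) (t : ℝ) (s s' : State) : Prop where
  pos : 1 ≤ s'.arrived
  starter : s.starter = skip K s'.starter
  arrived : s.arrived = s'.arrived + K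
  present : s.present = s'.present.map (skip K)
  age : ∀ i, s.age (skip K i) = s'.age i + if i = 0 then t else 0
  wait : s.wait = s'.wait
  zero_mem : 0 ∈ s'.present → s'.starter = 0

theorem fbStar_map (φ : ℕ ↪ ℕ) (i : ℕ) (S : Finset ℕ) :
    fbStar (φ i) (S.map φ) = (fbStar i S).map φ := by
  have : (S.map φ).erase (φ i) = (S.erase i).map φ := by
    ext k
    simp only [Finset.mem_erase, Finset.mem_map]
    constructor
    · rintro ⟨h, j, hj, rfl⟩
      exact ⟨j, ⟨fun hji => h (by rw [hji]), hj⟩, rfl⟩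
    · rintro ⟨j, ⟨h, hj⟩, rfl⟩
      exact ⟨fun hji => h (φ.injective hji), j, hj, rfl⟩
  rw [fbStar, fbStar, this]
  simp only [Finset.map_eq_empty]
  split_ifs <;> rfl

theorem Resumed.step {K : ℕ} {t : ℝ} {s s' : State} {a b a' b' : ℕ → ℝ} (h : Resumed K t s s')
    (ha : ∀ i, 2 ≤ i → a (i + K) = a' i)
    (hb : ∀ i, b (skip K i) = b' i + if i = 0 then t else 0) :
    Resumed K t (step fbStar a b s) (step fbStar a' b' s') := by
  have hE : fbStar s.starter s.present = (fbStar s'.starter s'.present).map (skip K) := by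
    rw [h.starter, h.present, fbStar_map]
  obtain ⟨δ, hδ⟩ : ∃ δ, ∀ i ∈ fbStar s'.starter s'.present, (if i = 0 then t else 0) = δ := by
    by_cases h0 : 0 ∈ fbStar s'.starter s'.present
    · refine ⟨t, fun i hi => ?_⟩
      have hs : s'.present.erase 0 = ∅ := by
        by_contra hne
        have hst : s'.starter = 0 := by
          refine h.zero_mem ?_
          rw [fbStar] at h0
          split_ifs at h0
          · exact h0
          · exact Finset.mem_of_mem_erase h0
        rw [fbStar, hst, if_neg hne] at h0
        simp at h0
      have hi' : i ∈ s'.present := by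
        rw [fbStar] at hi
        split_ifs at hi
        · exact hi
        · exact Finset.mem_of_mem_erase hi
      rw [if_pos]
      by_contra hi0
      have : i ∈ s'.present.erase 0 := Finset.mem_erase.2 ⟨hi0, hi'⟩
      simp [hs] at this
    · exact ⟨0, fun i hi => if_neg fun (hi0 : i = 0) => h0 (hi0 ▸ hi)⟩
  have hage : ∀ i ∈ fbStar s'.starter s'.present, s.age (skip K i) = s'.age i + δ :=
    fun i hi => by rw [h.age, hδ i hi]
  have hb' : ∀ i ∈ fbStar s'.starter s'.present, b (skip K i) = b' i + δ :=
    fun i hi => by rw [hb, hδ i hi]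
  have hH := holdingTime_map _ hE hage hb' h.wait
  have hN : ∀ i, nextAge fbStar b s (skip K i) =
      nextAge fbStar b' s' i + if i = 0 then t else 0 := fun i => by
    have h1 := nextAge_map _ hE hage hb' h.wait i
    have h2 := h.age i
    linarith
  have hP : remaining fbStar b s = (remaining fbStar b' s').map (skip K) := by
    ext k
    rw [Finset.mem_map]
    have key : ∀ i, skip K i ∈ remaining fbStar b s ↔ i ∈ remaining fbStar b' s' := fun i =>
      mem_remaining_map _ hE hage hb' h.wait (by rw [h.present, Finset.mem_map'])
    constructor
    · intro hk
      have hk' := (mem_remaining.1 hk).1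
      rw [h.present, Finset.mem_map] at hk'
      obtain ⟨i, -, rfl⟩ := hk'
      exact ⟨i, (key i).1 hk, rfl⟩
    · rintro ⟨i, hi, rfl⟩
      exact (key i).2 hi
  have hz : 0 ∈ remaining fbStar b' s' → s'.starter = 0 := fun h0 =>
    h.zero_mem (mem_remaining.1 h0).1
  have hp := h.pos
  rw [SingleServerQueue.step, SingleServerQueue.step, hH, h.wait]
  by_cases hc : holdingTime fbStar b' s' = s'.wait
  · rw [if_pos hc, if_pos hc]
    refine ⟨by simp, ?_, ?_, ?_, hN, ?_, ?_⟩
    · simp only [hP, Finset.map_eq_empty]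
      split_ifs
      · rw [h.arrived, skip_of_pos K hp]
      · exact h.starter
    · simp only [h.arrived]
      omega
    · simp only [hP, h.arrived, Finset.map_insert, skip_of_pos K hp]
    · simp only [h.arrived]
      rw [← ha _ (by omega)]
      congr 1
      omega
    · intro h0
      rcases Finset.mem_insert.1 h0 with h0 | h0
      · omega
      · rw [if_neg (Finset.ne_empty_of_mem h0)]
        exact hz h0
  · rw [if_neg hc, if_neg hc]
    exact ⟨hp, h.starter, h.arrived, hP, hN, by simp, hz⟩

theorem Resumed.busyLe_iff {K : ℕ} {t : ℝ} {s s' : State} {a b a' b' : ℕ → ℝ} {n : ℕ}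
    (h : Resumed K t s s') (ha : ∀ i, 2 ≤ i → a (i + K) = a' i)
    (hb : ∀ i, b (skip K i) = b' i + if i = 0 then t else 0) :
    BusyLe fbStar a b n s ↔ BusyLe fbStar a' b' n s' := by
  have key : ∀ k, Resumed K t ((SingleServerQueue.step fbStar a b)^[k] s)
      ((SingleServerQueue.step fbStar a' b')^[k] s') := fun k => by
    induction k with
    | zero => exact h
    | succ k ih =>
      rw [Function.iterate_succ_apply', Function.iterate_succ_apply']
      exact ih.step ha hb
  simp only [BusyLe, (key _).present, Finset.card_map, ne_eq, Finset.map_eq_empty]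

/-! ### Conservation of work -/

/-- Work brought by the first `k` customers, less the time from the first arrival to that of
customer `k - 1`. -/
def load (a b : ℕ → ℝ) (k : ℕ) : ℝ := ∑ i ∈ Finset.range k, b i - ∑ i ∈ Finset.Ico 1 k, a i

theorem load_succ (a b : ℕ → ℝ) {k : ℕ} (hk : 1 ≤ k) :
    load a b (k + 1) = load a b k + b k - a k := by
  rw [load, load, Finset.sum_range_succ, Finset.sum_Ico_succ_top hk]
  ring

theorem holdingTime_le_iff {R : PriorityRule} {b : ℕ → ℝ} {s : State} {c : ℝ} :
    holdingTime R b s ≤ c ↔ s.wait ≤ c ∨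
      (∃ i ∈ inService R s, ((inService R s).card : ℝ) * (b i - s.age i) ≤ c) ∨
      ∃ i ∈ inService R s, ∃ j ∈ R s.starter s.present \ inService R s,
        ((inService R s).card : ℝ) * (s.age j - s.age i) ≤ c := by
  simp only [holdingTime, min_le_iff, Finset.fold_min_le, Finset.mem_product, Prod.exists]
  constructor
  · rintro (h | (h | h) | h | ⟨i, j, ⟨hi, hj⟩, h⟩)
    · exact Or.inl h
    · exact Or.inl h
    · exact Or.inr (Or.inl h)
    · exact Or.inl h
    · exact Or.inr (Or.inr ⟨i, hi, j, hj, h⟩)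
  · rintro (h | h | ⟨i, hi, j, hj, h⟩)
    · exact Or.inl h
    · exact Or.inr (Or.inl (Or.inr h))
    · exact Or.inr (Or.inr (Or.inr ⟨i, j, ⟨hi, hj⟩, h⟩))

section Work

variable {b : ℕ → ℝ} {s : State}

theorem inService_fb_subset : inService fb s ⊆ s.present := fun _ hi => (mem_inService.1 hi).1

theorem inService_fb_nonempty (h : s.present ≠ ∅) : (inService fb s).Nonempty := by
  obtain ⟨i, hi, hmin⟩ := Finset.exists_min_image s.present s.age
    (Finset.nonempty_iff_ne_empty.2 h)
  exact ⟨i, mem_inService.2 ⟨hi, hmin⟩⟩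

theorem holdingTime_fb_nonneg (hb : ∀ i ∈ s.present, s.age i ≤ b i) (hw : 0 ≤ s.wait) :
    0 ≤ holdingTime fb b s := by
  refine le_holdingTime_iff.2 ⟨hw, fun i hi => ?_, fun i hi j hj => ?_⟩
  · exact mul_nonneg (Nat.cast_nonneg _) (sub_nonneg.2 (hb i (inService_fb_subset hi)))
  · exact mul_nonneg (Nat.cast_nonneg _)
      (sub_nonneg.2 ((mem_inService.1 hi).2 j (Finset.mem_sdiff.1 hj).1))

theorem nextAge_fb_le (hb : ∀ i ∈ s.present, s.age i ≤ b i) {i : ℕ} (hi : i ∈ s.present) :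
    nextAge fb b s i ≤ b i := by
  by_cases hY : i ∈ inService fb s
  · have hc : (0 : ℝ) < (inService fb s).card := by
      exact_mod_cast Finset.card_pos.2 ⟨i, hY⟩
    have := (le_holdingTime_iff.1 (le_refl (holdingTime fb b s))).2.1 i hY
    rw [nextAge_of_mem hY]
    have : holdingTime fb b s / ((inService fb s).card : ℝ) ≤ b i - s.age i := by
      rw [div_le_iff₀ hc]
      linarith
    linarith
  · rw [nextAge_of_notMem hY]
    exact hb i hi

theorem sum_remaining_fb (h : s.present ≠ ∅) (hb : ∀ i ∈ s.present, s.age i ≤ b i) :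
    ∑ i ∈ remaining fb b s, (b i - nextAge fb b s i) =
      ∑ i ∈ s.present, (b i - s.age i) - holdingTime fb b s := by
  have h1 : ∑ i ∈ remaining fb b s, (b i - nextAge fb b s i) =
      ∑ i ∈ s.present, (b i - nextAge fb b s i) := by
    refine Finset.sum_subset (fun i hi => (mem_remaining.1 hi).1) fun i hi hn => ?_
    have := nextAge_fb_le hb hi
    rw [mem_remaining, not_and, not_or] at hn
    have := (hn hi).2
    linarith
  have hc : ((inService fb s).card : ℝ) ≠ 0 := by
    exact_mod_cast (Finset.card_pos.2 (inService_fb_nonempty h)).ne'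
  have h2 : ∑ i ∈ s.present, (nextAge fb b s i - s.age i) = holdingTime fb b s := by
    rw [← Finset.sum_subset inService_fb_subset
      (fun i _ hn => by rw [nextAge_of_notMem hn, sub_self])]
    rw [Finset.sum_congr rfl fun i hi => by rw [nextAge_of_mem hi, add_sub_cancel_left],
      Finset.sum_const, nsmul_eq_mul, mul_div_cancel₀ _ hc]
  rw [h1, ← h2, ← Finset.sum_sub_distrib]
  exact Finset.sum_congr rfl fun i _ => by ring

theorem holdingTime_fb_le_work (h : s.present ≠ ∅) (hb : ∀ i ∈ s.present, s.age i ≤ b i) :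
    holdingTime fb b s ≤ ∑ i ∈ s.present, (b i - s.age i) := by
  have h1 := sum_remaining_fb h hb
  have h2 : 0 ≤ ∑ i ∈ remaining fb b s, (b i - nextAge fb b s i) :=
    Finset.sum_nonneg fun i hi => sub_nonneg.2 (nextAge_fb_le hb (mem_remaining.1 hi).1)
  linarith

end Work

/-- Properties of the states of a busy period under `FB`. -/
structure Regular (a b : ℕ → ℝ) (s : State) : Prop where
  pos : 1 ≤ s.arrived
  lt : ∀ i ∈ s.present, i < s.arrived
  age_le : ∀ i ∈ s.present, s.age i ≤ b i
  fresh : ∀ i, s.arrived ≤ i → s.age i = 0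
  wait_pos : 0 < s.wait
  wait_le : s.wait ≤ a s.arrived
  balance : ∑ i ∈ s.present, (b i - s.age i) = s.wait - a s.arrived + load a b s.arrived

theorem regular_start {a b : ℕ → ℝ} (ha : ∀ i, 1 ≤ i → 0 < a i) (hb : ∀ i, 0 ≤ b i) :
    Regular a b (start a) where
  pos := le_rfl
  lt := by simp [start]
  age_le := by simp [start, hb]
  fresh := by simp [start]
  wait_pos := ha 1 le_rfl
  wait_le := le_rfl
  balance := by simp [start, load]

theorem Regular.step {a b : ℕ → ℝ} (ha : ∀ i, 1 ≤ i → 0 < a i) (hb : ∀ i, 0 ≤ b i) {s : State}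
    (h : Regular a b s) (hne : s.present ≠ ∅) : Regular a b (step fb a b s) := by
  have hp := h.pos
  have hH0 := holdingTime_fb_nonneg h.age_le h.wait_pos.le
  have hHw := holdingTime_le_wait fb b s
  have hsum := sum_remaining_fb hne h.age_le
  have hnot : ∀ i, s.arrived ≤ i → nextAge fb b s i = 0 := fun i hi => by
    rw [nextAge_of_notMem fun hY => absurd (h.lt i (inService_fb_subset hY)) (by omega),
      h.fresh i hi]
  have hlt : ∀ i ∈ remaining fb b s, i < s.arrived := fun i hi => h.lt i (mem_remaining.1 hi).1
  have hle : ∀ i ∈ remaining fb b s, nextAge fb b s i ≤ b i := fun i hi =>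
    nextAge_fb_le h.age_le (mem_remaining.1 hi).1
  have hbal := h.balance
  rw [SingleServerQueue.step]
  by_cases hc : holdingTime fb b s = s.wait
  · rw [if_pos hc]
    have hnm : s.arrived ∉ remaining fb b s := fun hm => (hlt _ hm).false
    refine ⟨by simp, ?_, ?_, ?_, ha _ (by simp), le_rfl, ?_⟩
    · intro i hi
      simp only at hi ⊢
      rcases Finset.mem_insert.1 hi with rfl | hi
      · omega
      · have := hlt i hi; omega
    · intro i hi
      simp only at hi ⊢
      rcases Finset.mem_insert.1 hi with rfl | hi
      · rw [hnot _ le_rfl]; exact hb _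
      · exact hle i hi
    · intro i hi
      simp only at hi ⊢
      exact hnot i (by omega)
    · simp only
      rw [Finset.sum_insert hnm, hsum, hnot _ le_rfl, load_succ a b hp, hbal, hc]
      ring
  · rw [if_neg hc]
    have hlt' := lt_of_le_of_ne hHw hc
    refine ⟨hp, hlt, hle, hnot, ?_, ?_, ?_⟩
    · simp only
      linarith
    · have := h.wait_le
      simp only
      linarith
    · simp only
      rw [hsum, hbal]
      ring

theorem regular_iterate {a b : ℕ → ℝ} (ha : ∀ i, 1 ≤ i → 0 < a i) (hb : ∀ i, 0 ≤ b i) {k : ℕ}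
    (hk : ∀ j < k, ((step fb a b)^[j] (start a)).present ≠ ∅) :
    Regular a b ((step fb a b)^[k] (start a)) := by
  induction k with
  | zero => exact regular_start ha hb
  | succ k ih =>
    rw [Function.iterate_succ_apply']
    exact (ih fun j hj => hk j (by omega)).step ha hb (hk k (by omega))

/-! ### Busy periods that do not end -/

/-- Number of customers, plus number of pairs of customers of different ages. -/
def disorder (s : State) : ℕ :=
  s.present.card + ((s.present ×ˢ s.present).filter fun p => s.age p.1 ≠ s.age p.2).card

theorem disorder_step_lt {a b : ℕ → ℝ} {s : State} (hne : s.present ≠ ∅)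
    (hc : holdingTime fb b s ≠ s.wait) : disorder (step fb a b s) < disorder s := by
  have hlt := lt_of_le_of_ne (holdingTime_le_wait fb b s) hc
  rw [step, if_neg hc]
  have hsub : remaining fb b s ⊆ s.present := fun i hi => (mem_remaining.1 hi).1
  have hage : ∀ i ∈ s.present, ∀ j ∈ s.present, s.age i = s.age j →
      nextAge fb b s i = nextAge fb b s j := by
    intro i hi j hj hij
    have : i ∈ inService fb s ↔ j ∈ inService fb s := by
      rw [mem_inService, mem_inService, hij]
      exact and_congr_left fun _ => ⟨fun _ => hj, fun _ => hi⟩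
    by_cases hY : i ∈ inService fb s
    · rw [nextAge_of_mem hY, nextAge_of_mem (this.1 hY), hij]
    · rw [nextAge_of_notMem hY, nextAge_of_notMem (mt this.2 hY), hij]
  have hpairs : ((remaining fb b s ×ˢ remaining fb b s).filter
        fun p => nextAge fb b s p.1 ≠ nextAge fb b s p.2) ⊆
      (s.present ×ˢ s.present).filter fun p => s.age p.1 ≠ s.age p.2 := by
    intro p hp
    simp only [Finset.mem_filter, Finset.mem_product] at hp ⊢
    exact ⟨⟨hsub hp.1.1, hsub hp.1.2⟩, fun h => hp.2 (hage _ (hsub hp.1.1) _ (hsub hp.1.2) h)⟩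
  have hY0 : (0 : ℝ) < (inService fb s).card := by
    exact_mod_cast Finset.card_pos.2 (inService_fb_nonempty hne)
  rcases holdingTime_le_iff.1 (le_refl (holdingTime fb b s)) with
    h | ⟨i, hi, h⟩ | ⟨i, hi, j, hj, h⟩
  · exact absurd h (not_le.2 hlt)
  · refine add_lt_add_of_lt_of_le (Finset.card_lt_card ⟨hsub, fun hs => ?_⟩)
      (Finset.card_le_card hpairs)
    have := mem_remaining.1 (hs (inService_fb_subset hi))
    rcases this.2 with h2 | h2
    · exact h2 hi
    · rw [nextAge_of_mem hi] at h2
      have : b i - s.age i ≤ holdingTime fb b s / (inService fb s).card := by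
        rw [le_div_iff₀ hY0]; linarith
      linarith
  · by_cases hrem : i ∈ remaining fb b s ∧ j ∈ remaining fb b s
    · refine add_lt_add_of_le_of_lt (Finset.card_le_card hsub)
        (Finset.card_lt_card ⟨hpairs, fun hs => ?_⟩)
      obtain ⟨hjp, hjY⟩ := Finset.mem_sdiff.1 hj
      have hle := (le_holdingTime_iff.1 (le_refl (holdingTime fb b s))).2.2 i hi j hj
      have hij : nextAge fb b s i = nextAge fb b s j := by
        rw [nextAge_of_mem hi, nextAge_of_notMem hjY, le_antisymm hle h]
        field_simp
        ring
      have hne' : s.age i ≠ s.age j := fun he => hjY (mem_inService.2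
        ⟨hjp, fun l hl => he ▸ (mem_inService.1 hi).2 l hl⟩)
      have : (i, j) ∈ (s.present ×ˢ s.present).filter fun p => s.age p.1 ≠ s.age p.2 := by
        simp only [Finset.mem_filter, Finset.mem_product]
        exact ⟨⟨inService_fb_subset hi, hjp⟩, hne'⟩
      have := hs this
      simp only [Finset.mem_filter] at this
      exact this.2 hij
    · refine add_lt_add_of_lt_of_le (Finset.card_lt_card ⟨hsub, fun hs => hrem ⟨hs ?_, hs ?_⟩⟩)
        (Finset.card_le_card hpairs)
      · exact inService_fb_subset hi
      · exact (Finset.mem_sdiff.1 hj).1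

theorem exists_arrived {a b : ℕ → ℝ} {s : State}
    (hs : ∀ k, ((step fb a b)^[k] s).present ≠ ∅) :
    ∃ k, ((step fb a b)^[k] s).arrived = s.arrived + 1 := by
  induction hd : disorder s using Nat.strong_induction_on generalizing s with
  | _ d ih =>
    by_cases hc : holdingTime fb b s = s.wait
    · exact ⟨1, by simp [step, hc]⟩
    · have hst : (step fb a b s).arrived = s.arrived := by rw [step, if_neg hc]
      obtain ⟨k, hk⟩ := ih _ (hd ▸ disorder_step_lt (a := a) (hs 0) hc) (s := step fb a b s)
        (fun k => by rw [← Function.iterate_succ_apply]; exact hs (k + 1)) rfl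
      exact ⟨k + 1, by rw [Function.iterate_succ_apply, hk, hst]⟩

theorem load_nonneg_of_forall_not_endsIn {a b : ℕ → ℝ} (ha : ∀ i, 1 ≤ i → 0 < a i)
    (hb : ∀ i, 0 ≤ b i) (h : ∀ T, ¬ EndsIn fb a b T (start a)) {N : ℕ} (hN : 1 ≤ N) :
    0 ≤ load a b N := by
  have hne : ∀ k, ((step fb a b)^[k] (start a)).present ≠ ∅ := fun k => by
    induction k using Nat.strong_induction_on with
    | _ k ih => exact fun h0 => h k ⟨h0, ih⟩
  have hex : ∃ k, ((step fb a b)^[k] (start a)).arrived = N := by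
    induction N, hN using Nat.le_induction with
    | base => exact ⟨0, rfl⟩
    | succ N hN ih =>
      obtain ⟨k, hk⟩ := ih
      obtain ⟨l, hl⟩ := exists_arrived (a := a) (b := b) (s := (step fb a b)^[k] (start a))
        fun l => by rw [← Function.iterate_add_apply]; exact hne _
      exact ⟨l + k, by rw [Function.iterate_add_apply, hl, hk]⟩
  obtain ⟨k, hk⟩ := hex
  have hr := regular_iterate ha hb (k := k) fun j _ => hne j
  have h1 : 0 ≤ ∑ i ∈ ((step fb a b)^[k] (start a)).present,
      (b i - ((step fb a b)^[k] (start a)).age i) :=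
    Finset.sum_nonneg fun i hi => sub_nonneg.2 (hr.age_le i hi)
  have h2 := hr.balance
  have h3 := hr.wait_le
  rw [hk] at h2 h3
  linarith

/-! ### Busy periods that end -/

/-- The first busy period under `FB` ends after the service of exactly `k` customers, the queue
length being at most `m` throughout. -/
def EndsWith (a b : ℕ → ℝ) (m k : ℕ) : Prop :=
  ∃ T, EndsIn fb a b T (start a) ∧ ((step fb a b)^[T] (start a)).arrived = k ∧
    BusyLe fb a b m (start a)

theorem EndsIn.unique {R : PriorityRule} {a b : ℕ → ℝ} {s : State} {T T' : ℕ}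
    (h : EndsIn R a b T s) (h' : EndsIn R a b T' s) : T = T' := by
  rcases lt_trichotomy T T' with hlt | heq | hgt
  · exact absurd h.1 (h'.2 T hlt)
  · exact heq
  · exact absurd h'.1 (h.2 T' hgt)

theorem EndsWith.unique {a b : ℕ → ℝ} {m k k' : ℕ} (h : EndsWith a b m k)
    (h' : EndsWith a b m k') : k = k' := by
  obtain ⟨T, hT, rfl, -⟩ := h
  obtain ⟨T', hT', rfl, -⟩ := h'
  rw [hT.unique hT']

theorem EndsIn.load {a b : ℕ → ℝ} (ha : ∀ i, 1 ≤ i → 0 < a i) (hb : ∀ i, 0 ≤ b i) {T k : ℕ}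
    (hT : EndsIn fb a b T (start a)) (hk : ((step fb a b)^[T] (start a)).arrived = k) :
    1 ≤ k ∧ 0 ≤ load a b k ∧ load a b k < a k ∧
      ((step fb a b)^[T] (start a)).wait = a k - SingleServerQueue.load a b k ∧
      ∀ i, k ≤ i → ((step fb a b)^[T] (start a)).age i = 0 := by
  have hr := regular_iterate ha hb hT.2
  have h1 := hr.balance
  have h2 := hr.wait_le
  have h3 := hr.wait_pos
  have h4 := hr.pos
  have h5 := hr.fresh
  rw [hT.1, Finset.sum_empty, hk] at h1
  rw [hk] at h2 h4 h5
  exact ⟨h4, by linarith, by linarith, by linarith, h5⟩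

theorem arrived_le_step (R : PriorityRule) (a b : ℕ → ℝ) (s : State) :
    s.arrived ≤ (step R a b s).arrived := by
  rw [step]
  split_ifs <;> simp

theorem arrived_le_iterate (R : PriorityRule) (a b : ℕ → ℝ) (s : State) :
    ∀ k, s.arrived ≤ ((step R a b)^[k] s).arrived
  | 0 => le_rfl
  | k + 1 => by
    rw [Function.iterate_succ_apply']
    exact (arrived_le_iterate R a b s k).trans (arrived_le_step ..)

theorem holdingTime_le_of_wait {b b' : ℕ → ℝ} {s s' : State} (hp : s'.present = s.present)
    (hage : s'.age = s.age) (hb : ∀ i ∈ s.present, b' i = b i)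
    (hw : holdingTime fb b s ≤ s'.wait) : holdingTime fb b s ≤ holdingTime fb b' s' := by
  have hY : inService fb s' = inService fb s := by simp [inService, fb, hp, hage]
  have h := le_holdingTime_iff.1 (le_refl (holdingTime fb b s))
  refine le_holdingTime_iff.2 ⟨hw, ?_, ?_⟩
  · rw [hY, hage]
    intro i hi
    rw [hb i (inService_fb_subset hi)]
    exact h.2.1 i hi
  · rw [hY, hage, fb, hp]
    exact h.2.2

/-- The state `s` with the next arrival delayed by `δ` if it is that of customer `k`. -/
def State.delay (k : ℕ) (δ : ℝ) (s : State) : State :=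
  { s with wait := s.wait + if s.arrived = k then δ else 0 }

theorem step_delay {a b a' b' : ℕ → ℝ} {k : ℕ} {δ : ℝ} {s : State}
    (h : Regular a b s) (hne : s.present ≠ ∅) (hk : (step fb a b s).arrived ≤ k)
    (hload : load a b k < a k) (hload' : load a b k < a k + δ)
    (ha' : ∀ i, 1 ≤ i → i < k → a' i = a i) (hak : a' k = a k + δ) (hb' : ∀ i < k, b' i = b i) :
    step fb a' b' (s.delay k δ) = (step fb a b s).delay k δ := by
  have hk0 := (arrived_le_step fb a b s).trans hk
  have hbp : ∀ i ∈ s.present, b' i = b i := fun i hi => hb' i ((h.lt i hi).trans_le hk0)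
  have hwork := holdingTime_fb_le_work hne h.age_le
  have hwork' : holdingTime fb b' (s.delay k δ) ≤ ∑ i ∈ s.present, (b i - s.age i) := by
    refine (holdingTime_fb_le_work (s := s.delay k δ) hne ?_).trans_eq ?_
    · intro i hi
      rw [hbp i hi]
      exact h.age_le i hi
    · exact Finset.sum_congr rfl fun i hi => by rw [hbp i hi]; rfl
  have hbal := h.balance
  have hH : holdingTime fb b' (s.delay k δ) = holdingTime fb b s := by
    refine le_antisymm (holdingTime_le_of_wait rfl rfl (fun i hi => (hbp i hi).symm) ?_)
      (holdingTime_le_of_wait rfl rfl hbp ?_)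
    · by_cases hc : s.arrived = k
      · rw [hc] at hbal
        linarith
      · refine (holdingTime_le_wait _ _ _).trans_eq ?_
        simp [State.delay, hc]
    · by_cases hc : s.arrived = k
      · rw [hc] at hbal
        simp only [State.delay, if_pos hc]
        linarith
      · refine (holdingTime_le_wait _ _ _).trans_eq ?_
        simp [State.delay, hc]
  have hY : inService fb (s.delay k δ) = inService fb s := rfl
  have hN : nextAge fb b' (s.delay k δ) = nextAge fb b s := by
    funext i
    rw [nextAge, nextAge, hY, hH]
    rfl
  have hP : remaining fb b' (s.delay k δ) = remaining fb b s := by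
    ext i
    rw [mem_remaining, mem_remaining, hY, hN]
    exact and_congr_right fun hi => by rw [hbp i hi]
  by_cases hc : s.arrived = k
  · have hlt : holdingTime fb b s ≠ s.wait := fun he => by
      rw [hc] at hbal
      linarith
    have hlt' : holdingTime fb b' (s.delay k δ) ≠ (s.delay k δ).wait := fun he => by
      rw [hc] at hbal
      simp only [State.delay, if_pos hc] at he hwork'
      linarith
    rw [step, step, if_neg hlt, if_neg hlt', hH, hN, hP]
    simp only [State.delay, if_pos hc]
    congr 1
    ring
  · have hd : s.delay k δ = s := by simp [State.delay, hc]
    rw [hd] at hH hN hP ⊢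
    rw [step, step, hH, hN, hP]
    by_cases hw : holdingTime fb b s = s.wait
    · rw [step, if_pos hw] at hk
      simp only at hk
      rw [if_pos hw, if_pos hw]
      have : a' (s.arrived + 1) = a (s.arrived + 1) + if s.arrived + 1 = k then δ else 0 := by
        split_ifs with he
        · rw [he, hak]
        · rw [ha' _ (by omega) (by omega), add_zero]
      simp only [State.delay, this]
    · rw [if_neg hw, if_neg hw]
      simp [State.delay, hc]

/-- Whether the busy period ends with customer `k - 1`, and with queue lengths at most `m`, is
determined by what happens before the arrival of customer `k`, provided that this customer arrives
late enough. -/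
theorem EndsWith.congr {a b a' b' : ℕ → ℝ} (ha : ∀ i, 1 ≤ i → 0 < a i) (hb : ∀ i, 0 ≤ b i)
    {m k : ℕ} (h : EndsWith a b m k) (ha' : ∀ i, 1 ≤ i → i < k → a' i = a i)
    (hb' : ∀ i < k, b' i = b i) (hload : load a b k < a' k) : EndsWith a' b' m k := by
  obtain ⟨T, hT, hk, hm⟩ := h
  obtain ⟨hk1, -, hl, -, -⟩ := hT.load ha hb hk
  obtain ⟨δ, hδ⟩ : ∃ δ, a' k = a k + δ := ⟨a' k - a k, by ring⟩
  rw [hδ] at hload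
  have key : ∀ j ≤ T, (step fb a' b')^[j] (start a') =
      ((step fb a b)^[j] (start a)).delay k δ := by
    intro j hj
    induction j with
    | zero =>
      by_cases h1 : 1 = k
      · simp [State.delay, start, h1, hδ]
      · simp [State.delay, start, h1, ha' 1 le_rfl (by omega)]
    | succ j ih =>
      have hr := regular_iterate ha hb (k := j) fun i hi => hT.2 i (by omega)
      rw [Function.iterate_succ_apply', ih (by omega), Function.iterate_succ_apply']
      refine step_delay hr (hT.2 j (by omega)) ?_ hl hload ha' hδ hb'
      rw [← Function.iterate_succ_apply' (step fb a b) j, ← hk]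
      obtain ⟨l, rfl⟩ := Nat.exists_eq_add_of_le' hj
      rw [Function.iterate_add_apply]
      exact arrived_le_iterate ..
  have hp : ∀ j ≤ T, ((step fb a' b')^[j] (start a')).present =
      ((step fb a b)^[j] (start a)).present := fun j hj => by rw [key j hj]; rfl
  refine ⟨T, ⟨(hp T le_rfl).trans hT.1, fun j hj => (hp j hj.le).trans_ne (hT.2 j hj)⟩, ?_, ?_⟩
  · rw [key T le_rfl]
    exact hk
  · intro j hj
    have hjT : j < T := by
      by_contra hjT
      exact hj T (by omega) ((hp T le_rfl).trans hT.1)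
    rw [hp j hjT.le]
    exact hm j fun i hi => (hp i (by omega)).symm.trans_ne (hj i hi)

/-! ### Decomposition of a busy period under `FB*` -/

/-- Interarrival times, when the customers of `a` come after the starter of the busy period. -/
def consArrival (a : ℕ → ℝ) (i : ℕ) : ℝ := a (i - 1)

/-- Service times, when the customers of `b` come after a starter that requires `x`. -/
def consService (x : ℝ) (b : ℕ → ℝ) (i : ℕ) : ℝ := if i = 0 then x else b (i - 1)

/-- Under `FB*`, in a busy period whose starter requires service `x` and is followed by customers
with interarrival times `a` and service times `b`, the queue length is at most `n`. -/
def StarLe (n : ℕ) (x : ℝ) (a b : ℕ → ℝ) : Prop :=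
  BusyLe fbStar (consArrival a) (consService x b) n (start (consArrival a))

/-- Interarrival times from the end of a busy period of `k` customers on. -/
def restArrival (k : ℕ) (a b : ℕ → ℝ) (i : ℕ) : ℝ :=
  if i = 0 then a k - load a b k else a (k + i)

theorem inService_start (a : ℕ → ℝ) : inService fbStar (start a) = {0} := by
  ext i
  simp [mem_inService, start, fbStar]

theorem holdingTime_start (x : ℝ) (a b : ℕ → ℝ) :
    holdingTime fbStar (consService x b) (start (consArrival a)) = min (a 0) x := by
  refine eq_of_forall_le_iff fun c => ?_
  rw [le_holdingTime_iff, inService_start]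
  simp [start, fbStar, consArrival, consService]

theorem nextAge_start (x : ℝ) (a b : ℕ → ℝ) (i : ℕ) :
    nextAge fbStar (consService x b) (start (consArrival a)) i =
      if i = 0 then min (a 0) x else 0 := by
  by_cases h : i = 0
  · rw [nextAge_of_mem (by simp [inService_start, h]), holdingTime_start, inService_start]
    simp [start, h]
  · rw [nextAge_of_notMem (by simp [inService_start, h])]
    simp [start, h]

theorem starLe_of_lt {n : ℕ} (hn : 1 ≤ n) {x : ℝ} {a b : ℕ → ℝ} (h : x < a 0) :
    StarLe n x a b := by
  rw [StarLe, busyLe_iff (by simp [start])]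
  refine ⟨by simpa [start] using hn, busyLe_of_empty ?_⟩
  have hw : (start (consArrival a)).wait = a 0 := rfl
  rw [step, holdingTime_start, hw, if_neg (by rw [min_eq_right h.le]; exact h.ne)]
  ext i
  simp only [mem_remaining, inService_start, nextAge_start]
  simp only [start, Finset.mem_singleton, min_eq_right h.le, Finset.notMem_empty, iff_false,
    not_and, not_or, not_not]
  rintro rfl
  simp [consService]

theorem nested_start {x : ℝ} {a b : ℕ → ℝ} (h : a 0 < x) :
    Nested (a 0) (step fbStar (consArrival a) (consService x b) (start (consArrival a)))
      (start a) := by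
  have hw : (start (consArrival a)).wait = a 0 := rfl
  have hr : remaining fbStar (consService x b) (start (consArrival a)) = {0} := by
    ext i
    simp only [mem_remaining, inService_start, nextAge_start]
    simp only [start, Finset.mem_singleton, min_eq_left h.le, and_iff_left_iff_imp]
    rintro rfl
    simp [consService, h]
  rw [step, holdingTime_start, hw, if_pos (min_eq_left h.le), hr]
  refine ⟨by simp [start], rfl, ?_, ?_, ?_, rfl⟩
  · simp only [start, Finset.map_singleton, Function.Embedding.coeFn_mk]
    exact Finset.pair_comm ..
  · intro i
    exact (nextAge_start x a b (i + 1)).trans (if_neg (by omega))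
  · exact (nextAge_start x a b 0).trans (by simp [h.le])

theorem starLe_iff_of_endsIn {m T k : ℕ} {x : ℝ} {a b : ℕ → ℝ} (ha : ∀ i, 1 ≤ i → 0 < a i)
    (hb : ∀ i, 0 ≤ b i) (h : a 0 < x) (hT : EndsIn fb a b T (start a))
    (hk : ((step fb a b)^[T] (start a)).arrived = k) :
    StarLe (m + 1) x a b ↔ BusyLe fb a b m (start a) ∧
      StarLe (m + 1) (x - a 0) (restArrival k a b) (fun i => b (k + i)) := by
  obtain ⟨hk1, -, -, hwait, hfresh⟩ := hT.load ha hb hk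
  have ha1 : ∀ i, 1 ≤ i → consArrival a (i + 1) = a i := fun i _ => rfl
  have hb1 : ∀ i, consService x b (i + 1) = b i := fun i => rfl
  obtain ⟨h1, h2⟩ := (nested_start (b := b) h).busyLe_iff (m := m) ha1 hb1 T hT
  rw [StarLe, busyLe_iff (by simp [start]), h1]
  have hcard : (start (consArrival a)).present.card ≤ m + 1 := by simp [start]
  simp only [hcard, true_and]
  refine and_congr_right fun _ => ?_
  refine Resumed.busyLe_iff (K := k) (t := a 0) ⟨le_rfl, ?_, ?_, ?_, ?_, ?_, fun _ => rfl⟩ ?_ ?_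
  · rw [h2.starter]
    simp [start]
  · rw [h2.arrived, hk]
    simp [start, add_comm]
  · rw [h2.present, hT.1]
    simp [start]
  · intro i
    cases i with
    | zero => exact h2.age_zero.trans (zero_add _).symm
    | succ i =>
      rw [skip_of_pos k (by omega), show i + 1 + k = (k + i) + 1 by omega, h2.age,
        hfresh _ (by omega)]
      simp [start]
  · rw [h2.wait, hwait]
    simp [start, consArrival, restArrival]
  · intro i hi
    rw [consArrival, consArrival, restArrival, if_neg (by omega)]
    congr 1
    omega
  · intro i
    cases i with
    | zero => simp [consService]
    | succ i =>
      rw [skip_of_pos k (by omega)]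
      simp [consService]
      congr 1
      omega

theorem starLe_iff {m : ℕ} {x : ℝ} {a b : ℕ → ℝ} (ha : ∀ i, 1 ≤ i → 0 < a i)
    (hb : ∀ i, 0 ≤ b i) (h : a 0 < x) (hend : ∃ T, EndsIn fb a b T (start a)) :
    StarLe (m + 1) x a b ↔ ∃ k, EndsWith a b m k ∧
      StarLe (m + 1) (x - a 0) (restArrival k a b) (fun i => b (k + i)) := by
  constructor
  · intro H
    obtain ⟨T, hT⟩ := hend
    obtain ⟨h1, h2⟩ := (starLe_iff_of_endsIn ha hb h hT rfl).1 H
    exact ⟨_, ⟨T, hT, rfl, h1⟩, h2⟩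
  · rintro ⟨k, ⟨T, hT, hk, h1⟩, h2⟩
    exact (starLe_iff_of_endsIn ha hb h hT hk).2 ⟨h1, h2⟩

/-! ### Measurability -/

section Measurability

variable {X : Type*} [MeasurableSpace X]

/-- All the components of the state depend measurably on the parameter. -/
structure MeasurableState (S : X → State) : Prop where
  arrived : Measurable fun x => (S x).arrived
  starter : Measurable fun x => (S x).starter
  present : Measurable fun x => (S x).present
  age : ∀ i, Measurable fun x => (S x).age i
  wait : Measurable fun x => (S x).wait

variable {S : X → State} {R : PriorityRule} {a b : X → ℕ → ℝ}

theorem MeasurableState.rule (h : MeasurableState S) (R : PriorityRule) :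
    Measurable fun x => R (S x).starter (S x).present :=
  (measurable_of_countable fun p : ℕ × Finset ℕ => R p.1 p.2).comp (h.starter.prodMk h.present)

theorem MeasurableState.inService (h : MeasurableState S) (R : PriorityRule) :
    Measurable fun x => inService R (S x) := by
  refine measurable_finset_iff.2 fun i => ?_
  simp only [mem_inService]
  exact (measurable_finset_iff.1 (h.rule R) i).and (Measurable.forall fun j =>
    (measurable_finset_iff.1 (h.rule R) j).imp
      (measurableSet_setOfPred.1 (measurableSet_le (h.age i) (h.age j))))

theorem MeasurableState.card (h : MeasurableState S) (R : PriorityRule) :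
    Measurable fun x => ((SingleServerQueue.inService R (S x)).card : ℝ) :=
  (measurable_of_countable fun T : Finset ℕ => (T.card : ℝ)).comp (h.inService R)

theorem MeasurableState.holdingTime (h : MeasurableState S) (R : PriorityRule)
    (hb : ∀ i, Measurable fun x => b x i) :
    Measurable fun x => holdingTime R (b x) (S x) := by
  refine measurable_of_Ici fun c => ?_
  have hY := fun i => measurable_finset_iff.1 (h.inService R) i
  change MeasurableSet {x | c ≤ SingleServerQueue.holdingTime R (b x) (S x)}
  simp only [le_holdingTime_iff, Finset.mem_sdiff]
  have hle : ∀ {f : X → ℝ}, Measurable f → Measurable fun x => c ≤ f x := fun hf =>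
    measurableSet_setOfPred.1 (measurableSet_le measurable_const hf)
  refine measurableSet_setOfPred.2 ((hle h.wait).and (Measurable.and ?_ ?_))
  · exact Measurable.forall fun i => (hY i).imp (hle ((h.card R).mul ((hb i).sub (h.age i))))
  · exact Measurable.forall fun i => (hY i).imp (Measurable.forall fun j =>
      ((measurable_finset_iff.1 (h.rule R) j).and (hY j).not).imp
        (hle ((h.card R).mul ((h.age j).sub (h.age i)))))

theorem MeasurableState.nextAge (h : MeasurableState S) (R : PriorityRule)
    (hb : ∀ i, Measurable fun x => b x i) (i : ℕ) :
    Measurable fun x => nextAge R (b x) (S x) i :=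
  Measurable.ite (measurableSet_setOfPred.2 (measurable_finset_iff.1 (h.inService R) i))
    ((h.age i).add ((h.holdingTime R hb).div (h.card R))) (h.age i)

theorem MeasurableState.remaining (h : MeasurableState S) (R : PriorityRule)
    (hb : ∀ i, Measurable fun x => b x i) :
    Measurable fun x => remaining R (b x) (S x) := by
  refine measurable_finset_iff.2 fun i => ?_
  simp only [mem_remaining]
  exact (measurable_finset_iff.1 h.present i).and ((measurable_finset_iff.1 (h.inService R) i).not.or
    (measurableSet_setOfPred.1 (measurableSet_lt (h.nextAge R hb i) (hb i))))

theorem MeasurableState.step (h : MeasurableState S) (R : PriorityRule)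
    (ha : ∀ i, Measurable fun x => a x i) (hb : ∀ i, Measurable fun x => b x i) :
    MeasurableState fun x => step R (a x) (b x) (S x) := by
  have hH := h.holdingTime R hb
  have hr := h.remaining R hb
  have hc : MeasurableSet {x | SingleServerQueue.holdingTime R (b x) (S x) = (S x).wait} :=
    measurableSet_eq_fun hH h.wait
  have he : MeasurableSet {x | SingleServerQueue.remaining R (b x) (S x) = ∅} :=
    hr (measurableSet_singleton ∅)
  have hs : Measurable fun x =>
      if SingleServerQueue.remaining R (b x) (S x) = ∅ then (S x).arrived else (S x).starter :=
    Measurable.ite he h.arrived h.starter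
  have hi : Measurable fun x => insert (S x).arrived (SingleServerQueue.remaining R (b x) (S x)) :=
    (measurable_of_countable fun p : ℕ × Finset ℕ => insert p.1 p.2).comp (h.arrived.prodMk hr)
  have ha' : Measurable fun x => a x ((S x).arrived + 1) := by
    have : Measurable fun p : ℕ × X => a p.2 (p.1 + 1) :=
      measurable_from_prod_countable_right fun n => ha (n + 1)
    exact this.comp (h.arrived.prodMk measurable_id)
  refine ⟨?_, ?_, ?_, fun i => ?_, ?_⟩ <;>
    simp only [SingleServerQueue.step, apply_ite State.arrived, apply_ite State.starter,
      apply_ite State.present, apply_ite State.age, apply_ite State.wait]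
  · exact Measurable.ite hc (h.arrived.add_const 1) h.arrived
  · exact Measurable.ite hc hs h.starter
  · exact Measurable.ite hc hi hr
  · simpa only [ite_self] using h.nextAge R hb i
  · exact Measurable.ite hc ha' (h.wait.sub hH)

theorem MeasurableState.iterate (h : MeasurableState S) (R : PriorityRule)
    (ha : ∀ i, Measurable fun x => a x i) (hb : ∀ i, Measurable fun x => b x i) (k : ℕ) :
    MeasurableState fun x => (SingleServerQueue.step R (a x) (b x))^[k] (S x) := by
  induction k with
  | zero => exact h
  | succ k ih =>
    simp only [Function.iterate_succ_apply']
    exact ih.step R ha hb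

theorem measurableState_start (ha : ∀ i, Measurable fun x => a x i) :
    MeasurableState fun x => start (a x) :=
  ⟨measurable_const, measurable_const, measurable_const, fun _ => measurable_const, ha 1⟩

theorem MeasurableState.empty (h : MeasurableState S) : Measurable fun x => (S x).present = ∅ :=
  measurableSet_setOfPred.1 (h.present (measurableSet_singleton ∅))

theorem MeasurableState.busyLe (h : MeasurableState S) (R : PriorityRule)
    (ha : ∀ i, Measurable fun x => a x i) (hb : ∀ i, Measurable fun x => b x i) (n : ℕ) :
    Measurable fun x => BusyLe R (a x) (b x) n (S x) := by
  have hk := h.iterate R ha hb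
  refine Measurable.forall fun k => Measurable.imp (Measurable.forall fun j =>
    Measurable.imp measurable_const (hk j).empty.not) ?_
  exact (measurable_of_countable fun T : Finset ℕ => T.card ≤ n).comp (hk k).present

theorem MeasurableState.endsIn (h : MeasurableState S) (R : PriorityRule)
    (ha : ∀ i, Measurable fun x => a x i) (hb : ∀ i, Measurable fun x => b x i) (T : ℕ) :
    Measurable fun x => EndsIn R (a x) (b x) T (S x) := by
  have hk := h.iterate R ha hb
  exact (hk T).empty.and (Measurable.forall fun j => Measurable.imp measurable_const
    (hk j).empty.not)

theorem measurable_endsWith (ha : ∀ i, Measurable fun x => a x i)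
    (hb : ∀ i, Measurable fun x => b x i) (m k : ℕ) :
    Measurable fun x => EndsWith (a x) (b x) m k := by
  have hs := measurableState_start ha
  exact Measurable.exists fun T => (hs.endsIn fb ha hb T).and
    (((measurable_of_countable fun n : ℕ => n = k).comp (hs.iterate fb ha hb T).arrived).and
      (hs.busyLe fb ha hb m))

theorem measurable_starLe {f : X → ℝ} (hf : Measurable f) (ha : ∀ i, Measurable fun x => a x i)
    (hb : ∀ i, Measurable fun x => b x i) (n : ℕ) :
    Measurable fun x => StarLe n (f x) (a x) (b x) := by
  have ha' : ∀ i, Measurable fun x => consArrival (a x) i := fun i => ha (i - 1)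
  refine (measurableState_start ha').busyLe fbStar ha' (fun i => ?_) n
  cases i with
  | zero => simpa [consService] using hf
  | succ i => simpa [consService] using hb i

theorem measurable_load (ha : ∀ i, Measurable fun x => a x i)
    (hb : ∀ i, Measurable fun x => b x i) (k : ℕ) : Measurable fun x => load (a x) (b x) k :=
  (Finset.measurable_fun_sum _ fun i _ => hb i).sub (Finset.measurable_fun_sum _ fun i _ => ha i)

end Measurability

open Set

/-! ### The exponential distribution -/

section Exponential

variable {lam : ℝ}

theorem expMeasure_eq_withDensity (lam : ℝ) :
    expMeasure lam = volume.withDensity (exponentialPDF lam) := rfl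

theorem measurable_exponentialPDF (lam : ℝ) : Measurable (exponentialPDF lam) :=
  (measurable_exponentialPDFReal lam).ennreal_ofReal

theorem expMeasure_Iic (hlam : 0 < lam) {x : ℝ} (hx : 0 ≤ x) :
    expMeasure lam (Iic x) = ENNReal.ofReal (1 - Real.exp (-(lam * x))) := by
  have := isProbabilityMeasure_expMeasure hlam
  rw [← ofReal_cdf, cdf_expMeasure_eq hlam, if_pos hx]

theorem ae_expMeasure_pos (hlam : 0 < lam) : ∀ᵐ t ∂expMeasure lam, 0 < t := by
  rw [ae_iff]
  have : {t : ℝ | ¬ 0 < t} = Iic 0 := by ext; simp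
  rw [this, expMeasure_Iic hlam le_rfl]
  simp

theorem ae_expMeasure_ne (x : ℝ) : ∀ᵐ t ∂expMeasure lam, t ≠ x := by
  rw [expMeasure_eq_withDensity]
  exact (withDensity_absolutelyContinuous _ _).ae_le (Measure.ae_ne volume x)

theorem expMeasure_real_Ioi (hlam : 0 < lam) {x : ℝ} (hx : 0 ≤ x) :
    (expMeasure lam).real (Ioi x) = Real.exp (-(lam * x)) := by
  have := isProbabilityMeasure_expMeasure hlam
  rw [← compl_Iic, probReal_compl_eq_one_sub measurableSet_Iic, measureReal_def,
    expMeasure_Iic hlam hx, ENNReal.toReal_ofReal]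
  · ring
  · rw [sub_nonneg, Real.exp_le_one_iff]
    nlinarith

theorem expMeasure_real_Ioo_le (hlam : 0 < lam) {x : ℝ} (hx : 0 ≤ x) :
    (expMeasure lam).real (Ioo 0 x) ≤ 1 - Real.exp (-(lam * x)) := by
  have := isProbabilityMeasure_expMeasure hlam
  have h := probReal_compl_eq_one_sub (μ := expMeasure lam) (s := Ioi x) measurableSet_Ioi
  rw [expMeasure_real_Ioi hlam hx] at h
  rw [← h]
  exact measureReal_mono fun t ht => by simpa using ht.2.le

/-- The exponential distribution is memoryless. -/
theorem lintegral_expMeasure_shift {v : ℝ} (hv : 0 ≤ v) {g : ℝ → ENNReal}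
    (hg : Measurable g) :
    ∫⁻ t, (Ioi v).indicator (fun t => g (t - v)) t ∂expMeasure lam =
      ENNReal.ofReal (Real.exp (-(lam * v))) * ∫⁻ t, g t ∂expMeasure lam := by
  have hm := measurable_exponentialPDF lam
  have hg' : Measurable fun t => (Ioi v).indicator (fun t => g (t - v)) t :=
    (hg.comp (measurable_id.sub_const v)).indicator measurableSet_Ioi
  rw [expMeasure_eq_withDensity, lintegral_withDensity_eq_lintegral_mul _ hm hg',
    lintegral_withDensity_eq_lintegral_mul _ hm hg, ← lintegral_const_mul _ (hm.mul hg),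
    ← lintegral_add_right_eq_self _ v]
  refine lintegral_congr_ae ?_
  filter_upwards [Measure.ae_ne volume (0 : ℝ)] with t ht
  simp only [Pi.mul_apply]
  rcases lt_or_gt_of_ne ht with h | h
  · rw [indicator_of_notMem (by simp [h.le]), exponentialPDF_of_neg h]
    simp
  · rw [indicator_of_mem (by simp [h]), exponentialPDF_of_nonneg h.le,
      exponentialPDF_of_nonneg (by linarith), add_sub_cancel_right, ← mul_assoc,
      ← ENNReal.ofReal_mul (Real.exp_pos _).le]
    congr 2
    rw [mul_add, neg_add, Real.exp_add]
    ring

theorem integral_expMeasure (hlam : 0 < lam) (h : ℝ → ℝ) :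
    ∫ t, h t ∂expMeasure lam = ∫ t in Ioi 0, lam * Real.exp (-(lam * t)) * h t := by
  have hm := measurable_exponentialPDF lam
  rw [← setIntegral_eq_integral_of_ae_compl_eq_zero (s := Ioi (0 : ℝ)),
    expMeasure_eq_withDensity,
    setIntegral_withDensity_eq_setIntegral_toReal_smul hm
      (Filter.Eventually.of_forall fun _ => ENNReal.ofReal_lt_top) _ measurableSet_Ioi]
  · refine setIntegral_congr_fun measurableSet_Ioi fun t ht => ?_
    have : 0 ≤ lam * Real.exp (-(lam * t)) := by positivity
    simp only [smul_eq_mul]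
    rw [exponentialPDF_of_nonneg (le_of_lt ht), ENNReal.toReal_ofReal this]
  · filter_upwards [ae_expMeasure_pos hlam] with t ht h2
    exact absurd ht h2

theorem setIntegral_Ioo_expMeasure (hlam : 0 < lam) {x : ℝ} (hx : 0 ≤ x) (h : ℝ → ℝ) :
    ∫ t in Ioo 0 x, h t ∂expMeasure lam = ∫ t in 0..x, lam * Real.exp (-(lam * t)) * h t := by
  have hm := measurable_exponentialPDF lam
  rw [expMeasure_eq_withDensity, setIntegral_withDensity_eq_setIntegral_toReal_smul hm
      (Filter.Eventually.of_forall fun _ => ENNReal.ofReal_lt_top) _ measurableSet_Ioo,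
    intervalIntegral.integral_of_le hx, integral_Ioc_eq_integral_Ioo]
  refine setIntegral_congr_fun measurableSet_Ioo fun t ht => ?_
  have : 0 ≤ lam * Real.exp (-(lam * t)) := by positivity
  simp only [smul_eq_mul]
  rw [exponentialPDF_of_nonneg ht.1.le, ENNReal.toReal_ofReal this]

theorem integral_id_expMeasure (hlam : 0 < lam) : ∫ t, t ∂expMeasure lam = 1 / lam := by
  rw [integral_expMeasure hlam]
  have h := Real.integral_rpow_mul_exp_neg_mul_Ioi (a := 2) (r := lam) two_pos hlam
  have h2 : ∫ t in Ioi 0, lam * Real.exp (-(lam * t)) * t =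
      lam * ∫ t in Ioi 0, t ^ ((2 : ℝ) - 1) * Real.exp (-(lam * t)) := by
    rw [← integral_const_mul]
    refine setIntegral_congr_fun measurableSet_Ioi fun t _ => ?_
    norm_num
    ring
  rw [h2, h]
  have : Real.Gamma 2 = 1 := by
    simp
  rw [this, Real.rpow_two]
  field_simp

theorem integrable_id_expMeasure (hlam : 0 < lam) : Integrable (fun t => t) (expMeasure lam) := by
  refine Integrable.of_integral_ne_zero ?_
  rw [integral_id_expMeasure hlam]
  positivity

end Exponential

/-! ### A renewal equation -/

theorem renewal_exp {lam q : ℝ} (hlam : 0 < lam) {x : ℝ} (hx : 0 ≤ x) :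
    Real.exp (-(lam * (1 - q) * x)) = (expMeasure lam).real (Ioi x) +
      ∫ t in Ioo 0 x, q * Real.exp (-(lam * (1 - q) * (x - t))) ∂expMeasure lam := by
  rw [setIntegral_Ioo_expMeasure hlam hx, expMeasure_real_Ioi hlam hx]
  have hd : ∀ t ∈ uIcc 0 x, HasDerivAt
      (fun t => -(Real.exp (-(lam * (1 - q) * x)) * Real.exp (-(lam * q) * t)))
      (lam * Real.exp (-(lam * t)) * (q * Real.exp (-(lam * (1 - q) * (x - t))))) t := by
    intro t _
    have h1 : HasDerivAt (fun t : ℝ => -(lam * q) * t) (-(lam * q)) t := by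
      simpa using (hasDerivAt_id t).const_mul (-(lam * q))
    have h2 : Real.exp (-(lam * t)) * Real.exp (-(lam * (1 - q) * (x - t))) =
        Real.exp (-(lam * (1 - q) * x)) * Real.exp (-(lam * q) * t) := by
      rw [← Real.exp_add, ← Real.exp_add]
      ring_nf
    refine ((h1.exp.const_mul (Real.exp (-(lam * (1 - q) * x)))).fun_neg).congr_deriv ?_
    linear_combination -(lam * q) * h2
  rw [intervalIntegral.integral_eq_sub_of_hasDerivAt hd
    (Continuous.intervalIntegrable (by fun_prop) _ _)]
  have h3 : Real.exp (-(lam * (1 - q) * x)) * Real.exp (-(lam * q) * x) =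
      Real.exp (-(lam * x)) := by
    rw [← Real.exp_add]
    ring_nf
  rw [h3]
  simp

theorem renewal_unique {lam q : ℝ} (hlam : 0 < lam) (hq0 : 0 ≤ q) (hq1 : q ≤ 1) {f : ℝ → ℝ}
    (hf : Measurable f) (hf0 : ∀ x, 0 ≤ f x) (hf1 : ∀ x, f x ≤ 1)
    (hren : ∀ x, 0 ≤ x → f x = (expMeasure lam).real (Ioi x) +
      ∫ t in Ioo 0 x, q * f (x - t) ∂expMeasure lam) {x : ℝ} (hx : 0 ≤ x) :
    f x = Real.exp (-(lam * (1 - q) * x)) := by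
  have := isProbabilityMeasure_expMeasure hlam
  set g : ℝ → ℝ := fun x => Real.exp (-(lam * (1 - q) * x)) with hg
  have hgm : Measurable g := by fun_prop
  have hg1 : ∀ y, 0 ≤ y → g y ≤ 1 := fun y hy => by
    rw [hg, Real.exp_le_one_iff, neg_nonpos]
    have : 0 ≤ 1 - q := by linarith
    positivity
  have hbound : ∀ {y : ℝ} {h : ℝ → ℝ}, Measurable h → (∀ z, 0 ≤ z → 0 ≤ h z) →
      (∀ z, 0 ≤ z → h z ≤ 1) →
      IntegrableOn (fun t => q * h (y - t)) (Ioo 0 y) (expMeasure lam) := by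
    intro y h hm h0 h1
    refine Measure.integrableOn_of_bounded (M := 1) (measure_ne_top _ _)
      ((hm.comp (measurable_id.const_sub y)).const_mul q).aestronglyMeasurable ?_
    refine (ae_restrict_mem measurableSet_Ioo).mono fun t ht => ?_
    have h2 := h0 (y - t) (by linarith [ht.2])
    have h3 := h1 (y - t) (by linarith [ht.2])
    rw [Real.norm_of_nonneg (by positivity)]
    nlinarith
  set c := 1 - Real.exp (-(lam * x)) with hc
  have hc0 : 0 ≤ c := by
    rw [hc, sub_nonneg, Real.exp_le_one_iff, neg_nonpos]
    positivity
  have hc1 : c < 1 := by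
    have := Real.exp_pos (-(lam * x))
    linarith
  have key : ∀ n : ℕ, ∀ y, 0 ≤ y → y ≤ x → |f y - g y| ≤ c ^ n := by
    intro n
    induction n with
    | zero =>
      intro y hy _
      have h1 := hf0 y
      have h2 := hf1 y
      have h3 := hg1 y hy
      have h4 : 0 ≤ g y := (Real.exp_pos _).le
      rw [pow_zero, abs_le]
      constructor <;> linarith
    | succ n ih =>
      intro y hy hyx
      have hsub : f y - g y = ∫ t in Ioo 0 y, q * (f (y - t) - g (y - t)) ∂expMeasure lam := by
        have hgy : g y = _ := renewal_exp (q := q) hlam hy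
        rw [hren y hy, hgy, add_sub_add_left_eq_sub,
          ← integral_sub (hbound hf (fun z _ => hf0 z) fun z _ => hf1 z)
            (hbound hgm (fun z _ => (Real.exp_pos _).le) hg1)]
        simp only [mul_sub]
      rw [hsub, ← Real.norm_eq_abs]
      refine (norm_setIntegral_le_of_norm_le_const (C := c ^ n) (measure_lt_top _ _)
        fun t ht => ?_).trans ?_
      · have h1 := ih (y - t) (by linarith [ht.2]) (by linarith [ht.1])
        rw [Real.norm_eq_abs, abs_mul, abs_of_nonneg hq0]
        have h2 := abs_nonneg (f (y - t) - g (y - t))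
        nlinarith
      · rw [pow_succ]
        refine mul_le_mul_of_nonneg_left ((expMeasure_real_Ioo_le hlam hy).trans ?_)
          (pow_nonneg hc0 n)
        rw [hc]
        have : lam * y ≤ lam * x := mul_le_mul_of_nonneg_left hyx hlam.le
        have := Real.exp_le_exp.2 (neg_le_neg this)
        linarith
  have hlim := tendsto_pow_atTop_nhds_zero_of_lt_one hc0 hc1
  have h0 : |f x - g x| ≤ 0 :=
    ge_of_tendsto' hlim fun n => key n x hx le_rfl
  have := abs_nonpos_iff.1 h0
  linarith

/-! ### Infinite products of probability measures -/

section InfiniteProduct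

theorem measurable_update_prod {ι X : Type*} [MeasurableSpace X] [DecidableEq ι] (i : ι) :
    Measurable fun w : X × (ι → X) => Function.update w.2 i w.1 := by
  refine measurable_pi_lambda _ fun j => ?_
  by_cases h : j = i
  · subst h
    simpa using measurable_fst
  · simp only [Function.update_of_ne h]
    exact (measurable_pi_apply j).comp measurable_snd

variable {ι κ X : Type*} [MeasurableSpace X] (μ : ι → Measure X) [∀ i, IsProbabilityMeasure (μ i)]

theorem infinitePi_map_comp {σ : κ → ι} (hσ : Function.Injective σ) :
    (Measure.infinitePi μ).map (fun z k => z (σ k)) = Measure.infinitePi fun k => μ (σ k) := by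
  have h := (iIndepFun_infinitePi (P := μ) (X := fun _ x => x) fun _ => measurable_id).precomp hσ
  rw [iIndepFun_iff_map_fun_eq_infinitePi_map fun k => measurable_pi_apply (σ k)] at h
  rw [h]
  congr 1
  funext k
  exact (measurePreserving_eval_infinitePi μ (σ k)).map_eq

theorem infinitePi_prod_map_merge (p : ι → Prop) [DecidablePred p] :
    ((Measure.infinitePi μ).prod (Measure.infinitePi μ)).map
      (fun w i => if p i then w.1 i else w.2 i) = Measure.infinitePi μ := by
  have hm : Measurable fun (w : (ι → X) × (ι → X)) i => if p i then w.1 i else w.2 i := by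
    refine measurable_pi_lambda _ fun i => ?_
    split_ifs
    · exact (measurable_pi_apply i).comp measurable_fst
    · exact (measurable_pi_apply i).comp measurable_snd
  refine Measure.eq_infinitePi μ fun s t ht => ?_
  rw [Measure.map_apply hm (MeasurableSet.pi s.countable_toSet fun i _ => ht i)]
  have : (fun (w : (ι → X) × (ι → X)) i => if p i then w.1 i else w.2 i) ⁻¹' (s : Set ι).pi t =
      ((s.filter p : Finset ι) : Set ι).pi t ×ˢ
        ((s.filter fun i => ¬ p i : Finset ι) : Set ι).pi t := by
    ext w
    simp only [mem_preimage, mem_pi, Finset.mem_coe, mem_prod, Finset.mem_filter]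
    constructor
    · intro h
      refine ⟨fun i hi => ?_, fun i hi => ?_⟩
      · simpa [hi.2] using h i hi.1
      · simpa [hi.2] using h i hi.1
    · rintro ⟨h1, h2⟩ i hi
      by_cases hp : p i
      · simpa [hp] using h1 i ⟨hi, hp⟩
      · simpa [hp] using h2 i ⟨hi, hp⟩
  rw [this, Measure.prod_prod, Measure.infinitePi_pi μ fun i _ => ht i,
    Measure.infinitePi_pi μ fun i _ => ht i, Finset.prod_filter_mul_prod_filter_not]

theorem infinitePi_eq_lintegral_merge (p : ι → Prop) [DecidablePred p] {S : Set (ι → X)}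
    (hS : MeasurableSet S) :
    Measure.infinitePi μ S = ∫⁻ z, Measure.infinitePi μ
      {z' | (fun i => if p i then z i else z' i) ∈ S} ∂Measure.infinitePi μ := by
  have hm : Measurable fun (w : (ι → X) × (ι → X)) i => if p i then w.1 i else w.2 i := by
    refine measurable_pi_lambda _ fun i => ?_
    split_ifs
    · exact (measurable_pi_apply i).comp measurable_fst
    · exact (measurable_pi_apply i).comp measurable_snd
  conv_lhs => rw [← infinitePi_prod_map_merge μ p]
  rw [Measure.map_apply hm hS, Measure.prod_apply (hm hS)]
  rfl

theorem infinitePi_eq_lintegral_update [DecidableEq ι] (i : ι) {S : Set (ι → X)}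
    (hS : MeasurableSet S) :
    Measure.infinitePi μ S =
      ∫⁻ x, Measure.infinitePi μ {z | Function.update z i x ∈ S} ∂μ i := by
  have hm := measurable_update_prod (X := X) i
  have hg : Measurable fun x => Measure.infinitePi μ {z | Function.update z i x ∈ S} :=
    measurable_measure_prodMk_left (hm hS)
  rw [infinitePi_eq_lintegral_merge μ (· = i) hS,
    ← (measurePreserving_eval_infinitePi μ i).lintegral_comp hg]
  refine lintegral_congr fun z => ?_
  congr 1
  ext z'
  simp only [mem_ofPred_eq, Function.eval]
  rw [show (fun j => if j = i then z j else z' j) = Function.update z' i (z i) from ?_]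
  funext j
  by_cases h : j = i
  · subst h
    simp
  · simp [h]

end InfiniteProduct

/-! ### The input of the queue -/

/-- The distributions of the interarrival times and of the service times. -/
def inputMarginal (α ν : Measure ℝ) : ℕ ⊕ ℕ → Measure ℝ := Sum.elim (fun _ => α) fun _ => ν

instance (α ν : Measure ℝ) [IsProbabilityMeasure α] [IsProbabilityMeasure ν] (i : ℕ ⊕ ℕ) :
    IsProbabilityMeasure (inputMarginal α ν i) := by
  cases i <;> simpa [inputMarginal]

/-- The joint distribution of independent interarrival times with law `α` and service times with
law `ν`. -/
def inputLaw (α ν : Measure ℝ) [IsProbabilityMeasure α] [IsProbabilityMeasure ν] :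
    Measure (ℕ ⊕ ℕ → ℝ) := Measure.infinitePi (inputMarginal α ν)

instance (α ν : Measure ℝ) [IsProbabilityMeasure α] [IsProbabilityMeasure ν] :
    IsProbabilityMeasure (inputLaw α ν) := by
  unfold inputLaw
  infer_instance

/-- The interarrival times. -/
def arr (z : ℕ ⊕ ℕ → ℝ) (i : ℕ) : ℝ := z (Sum.inl i)

/-- The service times. -/
def srv (z : ℕ ⊕ ℕ → ℝ) (i : ℕ) : ℝ := z (Sum.inr i)

theorem measurable_arr (i : ℕ) : Measurable fun z => arr z i := measurable_pi_apply _

theorem measurable_srv (i : ℕ) : Measurable fun z => srv z i := measurable_pi_apply _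

/-- The input from customer `k` on. -/
def shift (k : ℕ) (z : ℕ ⊕ ℕ → ℝ) (i : ℕ ⊕ ℕ) : ℝ := z (Sum.map (k + ·) (k + ·) i)

/-- The input from the end of a busy period of `k` customers on. -/
def rest (k : ℕ) (z : ℕ ⊕ ℕ → ℝ) : ℕ ⊕ ℕ → ℝ :=
  Sum.elim (restArrival k (arr z) (srv z)) fun i => srv z (k + i)

theorem rest_eq (k : ℕ) (z : ℕ ⊕ ℕ → ℝ) :
    rest k z = Function.update (shift k z) (Sum.inl 0)
      (shift k z (Sum.inl 0) - load (arr z) (srv z) k) := by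
  funext i
  rcases i with i | i
  · cases i with
    | zero => simp [rest, restArrival, shift, arr]
    | succ i => simp [rest, restArrival, shift, arr]
  · simp [rest, shift, srv]

section Input

variable {α ν : Measure ℝ} [IsProbabilityMeasure α] [IsProbabilityMeasure ν]

theorem map_shift_inputLaw (k : ℕ) : (inputLaw α ν).map (shift k) = inputLaw α ν := by
  have hσ : Function.Injective (Sum.map (k + ·) (k + ·) : ℕ ⊕ ℕ → ℕ ⊕ ℕ) :=
    Sum.map_injective.2 ⟨add_right_injective k, add_right_injective k⟩
  refine (infinitePi_map_comp (inputMarginal α ν) hσ).trans ?_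
  unfold inputLaw
  congr 1
  funext i
  cases i <;> rfl

theorem measurable_shift (k : ℕ) : Measurable (shift k) :=
  measurable_pi_lambda _ fun _ => measurable_pi_apply _

theorem measurable_rest (k : ℕ) : Measurable (rest k) := by
  have h := measurable_load measurable_arr measurable_srv k
  refine measurable_pi_lambda _ fun i => ?_
  rcases i with i | i
  · cases i with
    | zero => exact (measurable_arr k).sub h
    | succ i => simpa [rest, restArrival] using measurable_arr (k + (i + 1))
  · exact measurable_srv (k + i)

theorem ae_inputLaw_arr {p : ℝ → Prop} (h : ∀ᵐ t ∂α, p t) :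
    ∀ᵐ z ∂inputLaw α ν, ∀ i, p (arr z i) := by
  rw [ae_all_iff]
  intro i
  exact (measurePreserving_eval_infinitePi (inputMarginal α ν)
    (Sum.inl i)).quasiMeasurePreserving.ae h

theorem ae_inputLaw_srv {p : ℝ → Prop} (h : ∀ᵐ t ∂ν, p t) :
    ∀ᵐ z ∂inputLaw α ν, ∀ i, p (srv z i) := by
  rw [ae_all_iff]
  intro i
  exact (measurePreserving_eval_infinitePi (inputMarginal α ν)
    (Sum.inr i)).quasiMeasurePreserving.ae h

end Input

/-! ### Renewal at the end of a busy period -/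

section Renewal

variable {lam : ℝ} {ν : Measure ℝ} [IsProbabilityMeasure (expMeasure lam)] [IsProbabilityMeasure ν]

theorem measurableSet_memoryless (v : ℝ) {S : Set (ℕ ⊕ ℕ → ℝ)} (hS : MeasurableSet S) :
    MeasurableSet
      {z | v < arr z 0 ∧ Function.update z (Sum.inl 0) (z (Sum.inl 0) - v) ∈ S} := by
  refine (measurableSet_lt measurable_const (measurable_arr 0)).inter ?_
  have h : Measurable fun z : ℕ ⊕ ℕ → ℝ => (z (Sum.inl 0) - v, z) :=
    ((measurable_arr 0).sub_const v).prodMk measurable_id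
  exact (measurable_update_prod (Sum.inl 0)).comp h hS

theorem inputLaw_memoryless {v : ℝ} (hv : 0 ≤ v) {S : Set (ℕ ⊕ ℕ → ℝ)} (hS : MeasurableSet S) :
    inputLaw (expMeasure lam) ν
        {z | v < arr z 0 ∧ Function.update z (Sum.inl 0) (z (Sum.inl 0) - v) ∈ S} =
      ENNReal.ofReal (Real.exp (-(lam * v))) * inputLaw (expMeasure lam) ν S := by
  have hS' := measurableSet_memoryless v hS
  have hg := measurable_measure_prodMk_left (ν := inputLaw (expMeasure lam) ν)
    (measurable_update_prod (Sum.inl 0) hS)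
  have h2 := infinitePi_eq_lintegral_update (inputMarginal (expMeasure lam) ν) (Sum.inl 0) hS
  have h1 := infinitePi_eq_lintegral_update (inputMarginal (expMeasure lam) ν) (Sum.inl 0) hS'
  have h3 := lintegral_expMeasure_shift (lam := lam) hv hg
  refine h1.trans (Eq.trans ?_ (h3.trans (congrArg _ h2.symm)))
  refine lintegral_congr fun t => ?_
  by_cases ht : v < t
  · rw [indicator_of_mem (by exact ht)]
    refine congrArg _ ?_
    ext z
    simp [arr, ht]
  · rw [indicator_of_notMem (by exact ht)]
    simp [arr, ht]

theorem inputLaw_endsWith_rest (hlam : 0 < lam) (hν : ∀ᵐ t ∂ν, 0 ≤ t) (m k : ℕ)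
    {S : Set (ℕ ⊕ ℕ → ℝ)} (hS : MeasurableSet S) :
    inputLaw (expMeasure lam) ν {z | EndsWith (arr z) (srv z) m k ∧ rest k z ∈ S} =
      inputLaw (expMeasure lam) ν {z | EndsWith (arr z) (srv z) m k} *
        inputLaw (expMeasure lam) ν S := by
  set Λ := inputLaw (expMeasure lam) ν with hΛ
  have hE : Measurable fun z => EndsWith (arr z) (srv z) m k :=
    measurable_endsWith measurable_arr measurable_srv m k
  have hload := measurable_load measurable_arr measurable_srv k
  -- the arrival of customer `k` is postponed beyond the end of the busy period
  let late : (ℕ ⊕ ℕ → ℝ) → ℕ → ℝ := fun z i =>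
    if i = k then |load (arr z) (srv z) k| + 1 else arr z i
  have hlate : ∀ i, Measurable fun z => late z i := fun i => by
    by_cases h : i = k
    · simp only [late, if_pos h]
      exact (measurable_norm.comp hload).add_const 1
    · simp only [late, if_neg h]
      exact measurable_arr i
  have hG : Measurable fun z => EndsWith (late z) (srv z) m k :=
    measurable_endsWith hlate measurable_srv m k
  have hgood : ∀ᵐ z ∂Λ, (∀ i, 0 < arr z i) ∧ ∀ i, 0 ≤ srv z i :=
    (ae_inputLaw_arr (ae_expMeasure_pos hlam)).and (ae_inputLaw_srv hν)
  let p : ℕ ⊕ ℕ → Prop := Sum.elim (· < k) (· < k)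
  have : DecidablePred p := fun i => by
    cases i <;> (simp only [p, Sum.elim_inl, Sum.elim_inr]; infer_instance)
  have main : ∀ S : Set (ℕ ⊕ ℕ → ℝ), MeasurableSet S →
      Λ {z | EndsWith (arr z) (srv z) m k ∧ rest k z ∈ S} =
        (∫⁻ z, {z | EndsWith (late z) (srv z) m k}.indicator
          (fun z => ENNReal.ofReal (Real.exp (-(lam * load (arr z) (srv z) k)))) z ∂Λ) * Λ S := by
    intro S hS
    have hmeas : MeasurableSet {z | EndsWith (arr z) (srv z) m k ∧ rest k z ∈ S} :=
      (measurableSet_setOfPred.2 hE).inter (measurable_rest k hS)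
    have hexp : Measurable fun z : ℕ ⊕ ℕ → ℝ =>
        ENNReal.ofReal (Real.exp (-(lam * load (arr z) (srv z) k))) := by
      fun_prop
    rw [← lintegral_mul_const _ (hexp.indicator (measurableSet_setOfPred.2 hG))]
    refine (infinitePi_eq_lintegral_merge _ p hmeas).trans (lintegral_congr_ae ?_)
    filter_upwards [hgood] with z hz
    set v := load (arr z) (srv z) k with hv
    have hll : load (late z) (srv z) k = v := by
      rw [hv, load, load]
      congr 1
      exact Finset.sum_congr rfl fun i hi => if_neg (Finset.mem_Ico.1 hi).2.ne
    have hlatepos : ∀ i, 1 ≤ i → 0 < late z i := fun i _ => by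
      simp only [late]
      split_ifs
      · positivity
      · exact hz.1 i
    have hlatek : late z k = |v| + 1 := if_pos rfl
    have hiff : ∀ᵐ z' ∂Λ, ((fun i => if p i then z i else z' i) ∈
        {z | EndsWith (arr z) (srv z) m k ∧ rest k z ∈ S} ↔
        EndsWith (late z) (srv z) m k ∧ shift k z' ∈ {y | v < arr y 0 ∧
          Function.update y (Sum.inl 0) (y (Sum.inl 0) - v) ∈ S}) := by
      filter_upwards [hgood] with z' hz'
      set w : ℕ ⊕ ℕ → ℝ := fun i => if p i then z i else z' i with hw
      have hwa : ∀ i < k, arr w i = arr z i := fun i hi => if_pos hi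
      have hwb : ∀ i < k, srv w i = srv z i := fun i hi => if_pos hi
      have hwpos : ∀ i, 1 ≤ i → 0 < arr w i := fun i _ => by
        simp only [arr, hw]
        split_ifs
        · exact hz.1 i
        · exact hz'.1 i
      have hwnn : ∀ i, 0 ≤ srv w i := fun i => by
        simp only [srv, hw]
        split_ifs
        · exact hz.2 i
        · exact hz'.2 i
      have hlw : load (arr w) (srv w) k = v := by
        rw [hv, load, load]
        congr 1
        · exact Finset.sum_congr rfl fun i hi => hwb i (Finset.mem_range.1 hi)
        · exact Finset.sum_congr rfl fun i hi => hwa i (Finset.mem_Ico.1 hi).2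
      have hshift : shift k w = shift k z' := by
        funext i
        rcases i with i | i <;> simp [shift, hw, p]
      have hwk : arr w k = arr (shift k z') 0 := by
        simp [arr, shift, hw, p]
      rw [rest_eq, hlw, hshift, ← and_assoc]
      refine and_congr_left fun _ => ⟨fun h => ⟨?_, ?_⟩, fun h => ?_⟩
      · refine h.congr hwpos hwnn (fun i _ hi => ?_) (fun i hi => (hwb i hi).symm) ?_
        · rw [hwa i hi]
          exact if_neg hi.ne
        · rw [hlw, hlatek]
          linarith [le_abs_self v]
      · obtain ⟨T, hT, hk, -⟩ := h
        have := (hT.load hwpos hwnn hk).2.2.1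
        rwa [hlw, hwk] at this
      · refine h.1.congr hlatepos hz.2 (fun i _ hi => ?_) hwb ?_
        · rw [hwa i hi]
          exact (if_neg hi.ne).symm
        · rw [hll, hwk]
          exact h.2
    have hset : Λ {z' | (fun i => if p i then z i else z' i) ∈
        {z | EndsWith (arr z) (srv z) m k ∧ rest k z ∈ S}} =
        Λ {z' | EndsWith (late z) (srv z) m k ∧ shift k z' ∈ {y | v < arr y 0 ∧
          Function.update y (Sum.inl 0) (y (Sum.inl 0) - v) ∈ S}} :=
      measure_congr (hiff.mono fun z' h => propext h)
    refine hset.trans ?_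
    by_cases hGz : EndsWith (late z) (srv z) m k
    · rw [indicator_of_mem (by exact hGz)]
      have hv0 : 0 ≤ v := by
        obtain ⟨T, hT, hk, -⟩ := hGz
        have := (hT.load hlatepos hz.2 hk).2.1
        rwa [hll] at this
      rw [← inputLaw_memoryless hv0 hS]
      simp only [hGz, true_and]
      have := Measure.map_apply (μ := Λ) (measurable_shift k)
        (measurableSet_memoryless v hS)
      rw [map_shift_inputLaw] at this
      exact this.symm
    · rw [indicator_of_notMem (by exact hGz)]
      simp [hGz]
  have h1 := main univ MeasurableSet.univ
  simp only [mem_univ, and_true, measure_univ, mul_one] at h1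
  rw [main S hS, h1]

end Renewal

section FirstArrival

variable {a a' b : ℕ → ℝ}

theorem start_congr (h : ∀ i, 1 ≤ i → a i = a' i) : start a = start a' := by
  rw [start, start, h 1 le_rfl]

theorem endsIn_start_congr {R : PriorityRule} (h : ∀ i, 1 ≤ i → a i = a' i) {T : ℕ} :
    EndsIn R a b T (start a) ↔ EndsIn R a' b T (start a') := by
  rw [start_congr h, EndsIn, EndsIn, step_congr h]

theorem busyLe_start_congr {R : PriorityRule} (h : ∀ i, 1 ≤ i → a i = a' i) {n : ℕ} :
    BusyLe R a b n (start a) ↔ BusyLe R a' b n (start a') := by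
  rw [start_congr h, BusyLe, BusyLe, step_congr h]

theorem endsWith_congr (h : ∀ i, 1 ≤ i → a i = a' i) {m k : ℕ} :
    EndsWith a b m k ↔ EndsWith a' b m k := by
  refine exists_congr fun T => ?_
  rw [endsIn_start_congr h, busyLe_start_congr h, step_congr h, start_congr h]

theorem load_congr (h : ∀ i, 1 ≤ i → a i = a' i) (k : ℕ) : load a b k = load a' b k := by
  rw [load, load]
  congr 1
  exact Finset.sum_congr rfl fun i hi => h i (Finset.mem_Ico.1 hi).1

theorem restArrival_congr (h : ∀ i, 1 ≤ i → a i = a' i) {k : ℕ} (hk : 1 ≤ k) :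
    restArrival k a b = restArrival k a' b := by
  funext i
  rw [restArrival, restArrival, load_congr h, h k hk, h (k + i) (by omega)]

end FirstArrival

/-! ### Busy periods end almost surely -/

section Law

variable {lam : ℝ} {ν : Measure ℝ} [IsProbabilityMeasure (expMeasure lam)] [IsProbabilityMeasure ν]

theorem ae_inputLaw_slln {α ν : Measure ℝ} [IsProbabilityMeasure α] [IsProbabilityMeasure ν]
    (f : ℕ → ℕ ⊕ ℕ) (hf : Function.Injective f) {μ : Measure ℝ} (hint : Integrable (fun t => t) μ)
    (hμ : ∀ i, inputMarginal α ν (f i) = μ) :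
    ∀ᵐ z ∂inputLaw α ν, Filter.Tendsto (fun n : ℕ => (∑ i ∈ Finset.range n, z (f i)) / (n : ℝ))
      Filter.atTop (nhds (∫ t : ℝ, t ∂μ)) := by
  have hmp : ∀ i, MeasurePreserving (fun z : ℕ ⊕ ℕ → ℝ => z (f i)) (inputLaw α ν) μ := fun i =>
    hμ i ▸ measurePreserving_eval_infinitePi (inputMarginal α ν) (f i)
  have hind := iIndepFun_infinitePi (P := inputMarginal α ν) (X := fun _ x => x)
    fun _ => measurable_id
  have h := strong_law_ae_real (μ := inputLaw α ν) (fun i z => z (f i))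
    ((hmp 0).integrable_comp_of_integrable hint)
    (fun i j hij => hind.indepFun (hf.ne hij))
    fun i => ⟨(hmp i).measurable.aemeasurable, (hmp 0).measurable.aemeasurable, by
      rw [(hmp i).map_eq, (hmp 0).map_eq]⟩
  have hval := integral_map (μ := inputLaw α ν) (hmp 0).measurable.aemeasurable (f := fun t : ℝ => t)
    measurable_id.aestronglyMeasurable
  rw [(hmp 0).map_eq] at hval
  rwa [← hval] at h

theorem ae_exists_endsIn (hlam : 0 < lam) (hν : ∀ᵐ t ∂ν, 0 ≤ t)
    (hint : Integrable (fun t => t) ν) (hload : lam * ∫ t, t ∂ν < 1) :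
    ∀ᵐ z ∂inputLaw (expMeasure lam) ν, ∃ T, EndsIn fb (arr z) (srv z) T (start (arr z)) := by
  filter_upwards [ae_inputLaw_arr (ae_expMeasure_pos hlam), ae_inputLaw_srv hν,
    ae_inputLaw_slln (α := expMeasure lam) (ν := ν) Sum.inl Sum.inl_injective
      (integrable_id_expMeasure hlam) fun _ => rfl,
    ae_inputLaw_slln (α := expMeasure lam) (ν := ν) Sum.inr Sum.inr_injective hint fun _ => rfl]
    with z ha hb hA hB
  by_contra hne
  push Not at hne
  have hl := fun N => load_nonneg_of_forall_not_endsIn (fun i _ => ha i) hb hne (N := N)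
  have h0 : Filter.Tendsto (fun n : ℕ => arr z 0 / (n : ℝ)) Filter.atTop (nhds 0) :=
    tendsto_const_div_atTop_nhds_zero_nat _
  have hlim := (hB.sub hA).add h0
  have hge : 0 ≤ (∫ t, t ∂ν) - (∫ t, t ∂expMeasure lam) + 0 := by
    refine ge_of_tendsto hlim (Filter.eventually_atTop.2 ⟨1, fun N hN => ?_⟩)
    have h1 := hl N hN
    rw [load] at h1
    have h2 : ∑ i ∈ Finset.range N, arr z i = arr z 0 + ∑ i ∈ Finset.Ico 1 N, arr z i := by
      rw [Finset.range_eq_Ico, Finset.sum_eq_sum_Ico_succ_bot (by omega)]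
    have h3 : (∑ i ∈ Finset.range N, z (Sum.inr i)) / N - (∑ i ∈ Finset.range N, z (Sum.inl i)) / N
        + arr z 0 / N = load (arr z) (srv z) N / N := by
      change (∑ i ∈ Finset.range N, srv z i) / (N : ℝ) - (∑ i ∈ Finset.range N, arr z i) / N
        + arr z 0 / N = _
      rw [h2, load]
      ring
    rw [h3, load]
    positivity
  rw [integral_id_expMeasure hlam] at hge
  have : lam * (1 / lam) = 1 := by field_simp
  nlinarith

/-! ### The distribution of the maximum under `FB*` -/

theorem measureReal_endsWith_rest (hlam : 0 < lam) (hν : ∀ᵐ t ∂ν, 0 ≤ t) (m : ℕ)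
    {S : Set (ℕ ⊕ ℕ → ℝ)} (hS : MeasurableSet S) :
    (inputLaw (expMeasure lam) ν).real {z | ∃ k, EndsWith (arr z) (srv z) m k ∧ rest k z ∈ S} =
      (inputLaw (expMeasure lam) ν).real {z | ∃ k, EndsWith (arr z) (srv z) m k} *
        (inputLaw (expMeasure lam) ν).real S := by
  have hE : ∀ k, MeasurableSet {z | EndsWith (arr z) (srv z) m k} := fun k =>
    measurableSet_setOfPred.2 (measurable_endsWith measurable_arr measurable_srv m k)
  have h1 : inputLaw (expMeasure lam) ν {z | ∃ k, EndsWith (arr z) (srv z) m k ∧ rest k z ∈ S} =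
      ∑' k, inputLaw (expMeasure lam) ν {z | EndsWith (arr z) (srv z) m k ∧ rest k z ∈ S} := by
    rw [← measure_iUnion]
    · congr 1
      ext z
      simp
    · intro k l hkl
      refine Set.disjoint_left.2 fun z hz hz' => hkl (hz.1.unique hz'.1)
    · exact fun k => (hE k).inter (measurable_rest k hS)
  have h2 : inputLaw (expMeasure lam) ν {z | ∃ k, EndsWith (arr z) (srv z) m k} =
      ∑' k, inputLaw (expMeasure lam) ν {z | EndsWith (arr z) (srv z) m k} := by
    rw [← measure_iUnion]
    · congr 1
      ext z
      simp
    · intro k l hkl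
      refine Set.disjoint_left.2 fun z hz hz' => hkl (EndsWith.unique hz hz')
    · exact hE
  simp only [measureReal_def]
  rw [h1, h2, ← ENNReal.toReal_mul, ← ENNReal.tsum_mul_right]
  simp only [inputLaw_endsWith_rest hlam hν m _ hS]

theorem measureReal_inputLaw_eq_integral_update {α ν : Measure ℝ} [IsProbabilityMeasure α]
    [IsProbabilityMeasure ν] (i : ℕ ⊕ ℕ) {S : Set (ℕ ⊕ ℕ → ℝ)} (hS : MeasurableSet S) :
    (inputLaw α ν).real S =
      ∫ t, (inputLaw α ν).real {z | Function.update z i t ∈ S} ∂inputMarginal α ν i := by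
  have h := infinitePi_eq_lintegral_update (inputMarginal α ν) i hS
  have hg : Measurable fun x => inputLaw α ν {z | Function.update z i x ∈ S} :=
    measurable_measure_prodMk_left (measurable_update_prod i hS)
  simp only [measureReal_def]
  rw [integral_toReal hg.aemeasurable (Filter.Eventually.of_forall fun _ => measure_lt_top _ _)]
  exact congrArg _ h

/-- Probability that under `FB*` the queue length is at most `n` during a busy period whose starter
requires service `x`. -/
def starProb (lam : ℝ) (ν : Measure ℝ) [IsProbabilityMeasure (expMeasure lam)]
    [IsProbabilityMeasure ν] (n : ℕ) (x : ℝ) : ℝ :=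
  (inputLaw (expMeasure lam) ν).real {z | StarLe n x (arr z) (srv z)}

theorem measurableSet_starLe (n : ℕ) (x : ℝ) :
    MeasurableSet {z : ℕ ⊕ ℕ → ℝ | StarLe n x (arr z) (srv z)} :=
  measurableSet_setOfPred.2 (measurable_starLe measurable_const measurable_arr measurable_srv n)

theorem measurable_starProb (n : ℕ) : Measurable (starProb lam ν n) := by
  have : MeasurableSet {w : ℝ × (ℕ ⊕ ℕ → ℝ) | StarLe n w.1 (arr w.2) (srv w.2)} :=
    measurableSet_setOfPred.2 (measurable_starLe measurable_fst
      (fun i => (measurable_arr i).comp measurable_snd)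
      (fun i => (measurable_srv i).comp measurable_snd) n)
  exact (measurable_measure_prodMk_left this).ennreal_toReal

theorem starProb_renewal (hlam : 0 < lam) (hν : ∀ᵐ t ∂ν, 0 ≤ t)
    (hint : Integrable (fun t => t) ν) (hload : lam * ∫ t, t ∂ν < 1) (m : ℕ) (x : ℝ) :
    starProb lam ν (m + 1) x = (expMeasure lam).real (Ioi x) + ∫ t in Ioo 0 x,
      (inputLaw (expMeasure lam) ν).real {z | ∃ k, EndsWith (arr z) (srv z) m k} *
        starProb lam ν (m + 1) (x - t) ∂expMeasure lam := by
  set q := (inputLaw (expMeasure lam) ν).real {z | ∃ k, EndsWith (arr z) (srv z) m k} with hq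
  have hF : Measurable fun t => q * starProb lam ν (m + 1) (x - t) :=
    ((measurable_starProb (m + 1)).comp (measurable_id.const_sub x)).const_mul q
  have hFint : Integrable (fun t => q * starProb lam ν (m + 1) (x - t)) (expMeasure lam) := by
    refine Integrable.of_bound hF.aestronglyMeasurable 1 (Filter.Eventually.of_forall fun t => ?_)
    have h1 : q ≤ 1 := measureReal_le_one
    have h2 : starProb lam ν (m + 1) (x - t) ≤ 1 := measureReal_le_one
    have h3 : 0 ≤ q := measureReal_nonneg
    have h4 : 0 ≤ starProb lam ν (m + 1) (x - t) := measureReal_nonneg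
    rw [Real.norm_of_nonneg (by positivity)]
    nlinarith
  have key : ∀ᵐ t ∂expMeasure lam, (inputLaw (expMeasure lam) ν).real
      {z | Function.update z (Sum.inl 0) t ∈ {z | StarLe (m + 1) x (arr z) (srv z)}} =
      (Ioi x).indicator 1 t +
        (Ioo 0 x).indicator (fun t => q * starProb lam ν (m + 1) (x - t)) t := by
    filter_upwards [ae_expMeasure_pos hlam, ae_expMeasure_ne x] with t ht0 htx
    rcases lt_or_gt_of_ne htx with h | h
    · rw [indicator_of_notMem (by simp [h.le]), zero_add,
        indicator_of_mem (show t ∈ Ioo 0 x from ⟨ht0, h⟩), starProb, hq,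
        ← measureReal_endsWith_rest hlam hν m (measurableSet_starLe _ _)]
      refine measureReal_congr ?_
      filter_upwards [ae_inputLaw_arr (ae_expMeasure_pos hlam), ae_inputLaw_srv hν,
        ae_exists_endsIn hlam hν hint hload] with z ha hb hT
      refine propext ?_
      have hc : ∀ i, 1 ≤ i → arr (Function.update z (Sum.inl 0) t) i = arr z i := fun i hi => by
        rw [arr, Function.update_of_ne (by simp; omega), arr]
      have hs : srv (Function.update z (Sum.inl 0) t) = srv z := by
        funext i
        rw [srv, Function.update_of_ne (by simp), srv]
      have h0 : arr (Function.update z (Sum.inl 0) t) 0 = t := by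
        rw [arr, Function.update_self]
      change StarLe _ _ _ _ ↔ ∃ k, _ ∧ StarLe _ _ _ _
      rw [hs, starLe_iff (fun i hi => (hc i hi).symm ▸ ha i) hb (by rwa [h0])
        (hT.imp fun T => (endsIn_start_congr hc).2), h0]
      refine exists_congr fun k => ?_
      rw [endsWith_congr hc]
      refine and_congr_right fun hk => ?_
      obtain ⟨T, hT, hk, -⟩ := hk
      rw [restArrival_congr hc (hT.load (fun i _ => ha i) hb hk).1]
      rfl
    · rw [indicator_of_mem (by exact h), indicator_of_notMem (fun h' => h.not_gt h'.2), add_zero,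
        Pi.one_apply]
      have : {z : ℕ ⊕ ℕ → ℝ | Function.update z (Sum.inl 0) t ∈
          {z | StarLe (m + 1) x (arr z) (srv z)}} = univ := by
        refine eq_univ_of_forall fun z => starLe_of_lt (by omega) ?_
        rwa [arr, Function.update_self]
      exact (congrArg _ this).trans probReal_univ
  rw [starProb, measureReal_inputLaw_eq_integral_update (Sum.inl 0) (measurableSet_starLe _ _)]
  refine (integral_congr_ae key).trans ?_
  have h1 : Integrable ((Ioi x).indicator (1 : ℝ → ℝ)) (expMeasure lam) :=
    (integrable_const (1 : ℝ)).indicator measurableSet_Ioi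
  rw [integral_add h1
    (hFint.indicator measurableSet_Ioo), integral_indicator measurableSet_Ioo,
    integral_indicator_one measurableSet_Ioi]

theorem starProb_eq (hlam : 0 < lam) (hν : ∀ᵐ t ∂ν, 0 ≤ t)
    (hint : Integrable (fun t => t) ν) (hload : lam * ∫ t, t ∂ν < 1) (m : ℕ) {x : ℝ}
    (hx : 0 ≤ x) :
    starProb lam ν (m + 1) x = Real.exp (-(lam * (1 - (inputLaw (expMeasure lam) ν).real
      {z | BusyLe fb (arr z) (srv z) m (start (arr z))}) * x)) := by
  have hq : (inputLaw (expMeasure lam) ν).real {z | ∃ k, EndsWith (arr z) (srv z) m k} =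
      (inputLaw (expMeasure lam) ν).real {z | BusyLe fb (arr z) (srv z) m (start (arr z))} := by
    refine measureReal_congr ?_
    filter_upwards [ae_exists_endsIn hlam hν hint hload] with z hT
    refine propext ⟨?_, fun h => ?_⟩
    · rintro ⟨k, T, -, -, h⟩
      exact h
    · obtain ⟨T, hT⟩ := hT
      exact ⟨_, T, hT, rfl, h⟩
  rw [← hq]
  exact renewal_unique hlam measureReal_nonneg measureReal_le_one (measurable_starProb _)
    (fun _ => measureReal_nonneg) (fun _ => measureReal_le_one)
    (fun x _ => starProb_renewal hlam hν hint hload m x) hx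

theorem measureReal_busyLe_fbStar (hlam : 0 < lam) (hν : ∀ᵐ t ∂ν, 0 ≤ t)
    (hint : Integrable (fun t => t) ν) (hload : lam * ∫ t, t ∂ν < 1) (m : ℕ) :
    (inputLaw (expMeasure lam) ν).real
        {z | BusyLe fbStar (arr z) (srv z) (m + 1) (start (arr z))} =
      ∫ x, Real.exp (-(lam * (1 - (inputLaw (expMeasure lam) ν).real
        {z | BusyLe fb (arr z) (srv z) m (start (arr z))}) * x)) ∂ν := by
  have hm : MeasurableSet
      {z : ℕ ⊕ ℕ → ℝ | BusyLe fbStar (arr z) (srv z) (m + 1) (start (arr z))} :=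
    measurableSet_setOfPred.2
      ((measurableState_start measurable_arr).busyLe fbStar measurable_arr measurable_srv _)
  rw [measureReal_inputLaw_eq_integral_update (Sum.inr 0) hm]
  refine integral_congr_ae (hν.mono fun x hx => ?_)
  beta_reduce
  rw [← starProb_eq hlam hν hint hload m hx, starProb]
  have hS := measurableSet_starLe (m + 1) x
  have : {z : ℕ ⊕ ℕ → ℝ | Function.update z (Sum.inr 0) x ∈
      {z | BusyLe fbStar (arr z) (srv z) (m + 1) (start (arr z))}} =
      shift 1 ⁻¹' {z | StarLe (m + 1) x (arr z) (srv z)} := by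
    ext z
    have ha : ∀ i, 1 ≤ i → arr (Function.update z (Sum.inr 0) x) i =
        consArrival (arr (shift 1 z)) i := fun i hi => by
      simp [arr, consArrival, shift, Nat.add_sub_cancel' hi]
    have hb : srv (Function.update z (Sum.inr 0) x) = consService x (srv (shift 1 z)) := by
      funext i
      cases i with
      | zero => simp [srv, consService]
      | succ i => simp [srv, consService, shift, add_comm]
    change BusyLe _ _ _ _ _ ↔ StarLe _ _ _ _
    rw [busyLe_start_congr ha, hb, StarLe]
  simp only [measureReal_def]
  rw [this, ← Measure.map_apply (measurable_shift 1) hS, map_shift_inputLaw]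

end Law

theorem map_eq_inputLaw {Ω : Type*} [MeasurableSpace Ω] {P : Measure Ω} [IsProbabilityMeasure P]
    {α ν : Measure ℝ} [IsProbabilityMeasure α] [IsProbabilityMeasure ν] {A B : ℕ → Ω → ℝ}
    (hA : ∀ i, Measurable (A i)) (hB : ∀ i, Measurable (B i))
    (hA_law : ∀ i, P.map (A i) = α) (hB_law : ∀ i, P.map (B i) = ν)
    (h_indep : iIndepFun (Sum.elim A B : ℕ ⊕ ℕ → Ω → ℝ) P) :
    P.map (fun ω i => (Sum.elim A B : ℕ ⊕ ℕ → Ω → ℝ) i ω) = inputLaw α ν := by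
  have hm : ∀ i, Measurable ((Sum.elim A B : ℕ ⊕ ℕ → Ω → ℝ) i) := by
    rintro (i | i)
    · exact hA i
    · exact hB i
  rw [(iIndepFun_iff_map_fun_eq_infinitePi_map hm).1 h_indep, inputLaw]
  congr 1
  funext i
  rcases i with i | i
  · exact hA_law i
  · exact hB_law i

end SingleServerQueue

end

theorem proposition2p1 {Ω : Type*} [MeasurableSpace Ω] (P : Measure Ω) [IsProbabilityMeasure P]
    (lam : ℝ) (hlam : 0 < lam)
    -- interarrival times `A i` and service times `B i`
    (A B : ℕ → Ω → ℝ)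
    (hA : ∀ i, Measurable (A i)) (hB : ∀ i, Measurable (B i))
    (hA_law : ∀ i, P.map (A i) = expMeasure lam)
    (hB_ident : ∀ i, IdentDistrib (B i) (B 0) P P)
    (hB_nonneg : ∀ᵐ ω ∂P, 0 ≤ B 0 ω)
    (h_indep : iIndepFun (Sum.elim A B : ℕ ⊕ ℕ → Ω → ℝ) P)
    -- the load is less than one
    (hB_int : Integrable (B 0) P) (h_load : lam * ∫ ω, B 0 ω ∂P < 1)
    -- maximum queue lengths in the first busy period under `FB` and `FB*`
    (M Mstar : Ω → ℕ∞)
    (hM : ∀ ω, M ω = SingleServerQueue.busyPeriodMax SingleServerQueue.fb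
      (fun i => A i ω) (fun i => B i ω))
    (hMstar : ∀ ω, Mstar ω = SingleServerQueue.busyPeriodMax SingleServerQueue.fbStar
      (fun i => A i ω) (fun i => B i ω))
    (n : ℕ) (hn : 1 ≤ n) :
    P.real {ω | (n : ℕ∞) < Mstar ω} =
      1 - ∫ ω, Real.exp (-(lam * P.real {ω' | ((n - 1 : ℕ) : ℕ∞) < M ω'} * B 0 ω)) ∂P := by
  open SingleServerQueue in
  obtain ⟨m, rfl⟩ := Nat.exists_eq_add_of_le' hn
  have := isProbabilityMeasure_expMeasure hlam
  set ν := P.map (B 0) with hν_def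
  have : IsProbabilityMeasure ν := Measure.isProbabilityMeasure_map (hB 0).aemeasurable
  have hν : ∀ᵐ t ∂ν, 0 ≤ t :=
    (ae_map_iff (hB 0).aemeasurable measurableSet_Ici).2 hB_nonneg
  have hint : Integrable (fun t => t) ν :=
    (integrable_map_measure measurable_id.aestronglyMeasurable (hB 0).aemeasurable).2 hB_int
  have hmean : ∫ t, t ∂ν = ∫ ω, B 0 ω ∂P :=
    integral_map (hB 0).aemeasurable measurable_id.aestronglyMeasurable
  have hlaw := map_eq_inputLaw hA hB hA_law (fun i => (hB_ident i).map_eq) h_indep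
  have hX : Measurable fun ω i => (Sum.elim A B : ℕ ⊕ ℕ → Ω → ℝ) i ω := by
    refine measurable_pi_lambda _ ?_
    rintro (i | i)
    · exact hA i
    · exact hB i
  have hprob : ∀ (R : PriorityRule), (∀ i, R i ∅ = ∅) → ∀ (k : ℕ) (N : Ω → ℕ∞),
      (∀ ω, N ω = busyPeriodMax R (fun i => A i ω) (fun i => B i ω)) →
      P.real {ω | (k : ℕ∞) < N ω} = 1 - (inputLaw (expMeasure lam) ν).real
        {z | BusyLe R (arr z) (srv z) k (start (arr z))} := by
    intro R hR k N hN
    have hS : MeasurableSet {z | BusyLe R (arr z) (srv z) k (start (arr z))} :=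
      measurableSet_setOfPred.2
        ((measurableState_start measurable_arr).busyLe R measurable_arr measurable_srv k)
    rw [← probReal_compl_eq_one_sub hS, ← hlaw, map_measureReal_apply hX hS.compl]
    congr 1
    ext ω
    change _ < N ω ↔ ¬ BusyLe _ _ _ _ _
    rw [← busyPeriodMax_le_iff hR, not_le, hN]
    rfl
  rw [hprob fbStar fbStar_empty (m + 1) Mstar hMstar,
    measureReal_busyLe_fbStar hlam hν hint (by rwa [hmean]) m, Nat.add_sub_cancel,
    hprob fb fb_empty m M hM,
    integral_map (hB 0).aemeasurable
      (Continuous.aestronglyMeasurable (by fun_prop))]
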